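/- Let $V$ be a real potential and let $H$ be the self-adjoint discrete Schrödinger operator $[H\psi](n)=\psi(n+1)+\psi(n-1)+V(n)\psi(n)$ on $\ell^2(\mathbb Z)$, or on $\ell^2(\mathbb Z_+)$, $\mathbb Z_+=\{1,2,\dots\}$, with the Dirichlet condition $\psi(0)=0$. For $p,T>0$ put $$\langle |X|^p_{\delta_1}\rangle(T)=\sum_n |n|^p\,a(n,T),\qquad a(n,T)=\frac2T\int_0^\infty e^{-2t/T}\,|\langle e^{-itH}\delta_1,\delta_n\rangle|^2\,dt .$$ Let $F(z)=\langle (H-z)^{-1}\delta_1,\delta_1\rangle$ and, for $\Delta\subseteq\mathbb R$ and $\nu>0$, $I(\Delta,\nu)=\nu\int_\Delta(\operatorname{Im}F(E+i\nu))^2\,dE$; write $\Delta_\nu$ for the $\nu$-neighborhood of $\Delta$. For real sequences $u=(u(n))_{n\ge 0}$ and $L\ge 0$ put $\|u\|_L^2=\sum_{n=1}^{[L]}|u(n)|^2+(L-[L])\,|u([L]+1)|^2$. A solution at energy $E$ is a real $u$ with $u(n+1)+u(n-1)+V(n)u(n)=Eu(n)$ for all $n\ge1$; it is normalized if $|u(0)|^2+|u(1)|^2=1$.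 Let $A\subseteq\mathbb R$ and assume: (a) there are $C,\alpha>0$ such that $\|u\|_L^2\le C L^{2\alpha+1}$ for every $E\in A$, every normalized solution $u$ at energy $E$ and every $L\ge1$; (b) there are $0<k,\gamma<1$ and $L_0\ge1$ such that $\|u\|_L^2\ge(1+\gamma)\|u\|_{kL}^2$ for every $E\in A$, every solution $u$ at energy $E$ and every $L\ge L_0$. Then there are $D,\kappa>0$ and $L_1\ge 1$ such that (c) $\|u\|_L\ge D L^\kappa$ for every $E\in A$, every normalized solution $u$ at energy $E$ and every $L\ge L_1$. Moreover, for all $D,\kappa>0$ and $L_1\ge1$ for which (c) holds there is $T_0>0$ such that for all $T\ge T_0$, with $\varepsilon=1/T$, and all $p>0$ the following bounds hold. If $p\le2\alpha+1$, then $$\langle |X|^p_{\delta_1}\rangle(T)\ \ge\ \frac{\gamma k^p}{12\pi}\Big(\frac{\gamma^2}{5184\,C}\Big)^{\frac{p+2\kappa}{2\alpha+1+2\kappa}}D^{2-\frac{2(p+2\kappa)}{2\alpha+1+2\kappa}}\;T^{\frac{2(p+2\kappa)}{2\alpha+1+2\kappa}}\,I(A_{2\varepsilon},\varepsilon).$$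 If $p>2\alpha+1$, then $$\langle |X|^p_{\delta_1}\rangle(T)\ \ge\ \frac{\gamma k^{2\alpha+1}}{12\pi}\,\frac{\gamma^2}{5184\,C}\;T^2\,I(A_{2\varepsilon},\varepsilon)$$ and $$\langle |X|^p_{\delta_1}\rangle(T)\ \ge\ \frac{\gamma k^p}{12\pi}\Big(\frac{\gamma^2}{5184\,C^2}\Big)^{\frac{p+2\kappa}{2}}D^2\;T^{\frac{p+2\kappa}{2\alpha+1}}\,I(A_{2\varepsilon},\varepsilon).$$ -/

import Mathlib

open scoped ENNReal

noncomputable section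

namespace Schrodinger1D

/-! ### The Hilbert space and the operator -/

/-- The two settings: `ℓ²(ℤ)` and `ℓ²(ℤ₊)`, where `ℤ₊ = {1, 2, …}`. -/
inductive Lattice where
  | wholeLine
  | halfLine

/-- The set of sites of the lattice, as a subset of `ℤ`. -/
def Lattice.sites : Lattice → Set ℤ
  | .wholeLine => Set.univ
  | .halfLine => Set.Ici 1

/-- The site `1`. -/
def Lattice.one : (X : Lattice) → X.sites
  | .wholeLine => ⟨1, Set.mem_univ 1⟩
  | .halfLine => ⟨1, Set.self_mem_Ici⟩

/-- The Hilbert space `ℓ²(ℤ)` or `ℓ²(ℤ₊)`. -/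
abbrev Ell2 (X : Lattice) : Type := lp (fun _ : X.sites => ℂ) 2

/-- The unit vector `δ_n`. -/
def delta (X : Lattice) (n : X.sites) : Ell2 X := lp.single 2 n 1

/-- Extension of a function on the sites by zero to all of `ℤ`; on the half-line this is the
Dirichlet boundary condition `ψ(0) = 0`. -/
def zeroExt {X : Lattice} (ψ : X.sites → ℂ) (n : ℤ) : ℂ :=
  open Classical in if h : n ∈ X.sites then ψ ⟨n, h⟩ else 0

/-- The formal difference expression `ψ(n+1) + ψ(n-1) + V(n) ψ(n)`. On the half-line only the
values `V(n)`, `n ≥ 1`, matter. -/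
def diffExpr (X : Lattice) (V : ℤ → ℝ) (ψ : X.sites → ℂ) (n : X.sites) : ℂ :=
  zeroExt ψ (n + 1) + zeroExt ψ (n - 1) + (V n : ℂ) * ψ n

theorem zeroExt_add {X : Lattice} (ψ φ : X.sites → ℂ) (n : ℤ) :
    zeroExt (ψ + φ) n = zeroExt ψ n + zeroExt φ n := by
  unfold zeroExt; split_ifs <;> simp

theorem zeroExt_smul {X : Lattice} (c : ℂ) (ψ : X.sites → ℂ) (n : ℤ) :
    zeroExt (c • ψ) n = c * zeroExt ψ n := by
  unfold zeroExt; split_ifs <;> simp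

theorem diffExpr_add (X : Lattice) (V : ℤ → ℝ) (ψ φ : X.sites → ℂ) :
    diffExpr X V (ψ + φ) = diffExpr X V ψ + diffExpr X V φ := by
  funext n; simp only [diffExpr, zeroExt_add, Pi.add_apply]; ring

theorem diffExpr_smul (X : Lattice) (V : ℤ → ℝ) (c : ℂ) (ψ : X.sites → ℂ) :
    diffExpr X V (c • ψ) = c • diffExpr X V ψ := by
  funext n; simp only [diffExpr, zeroExt_smul, Pi.smul_apply, smul_eq_mul]; ring

/-- The Schrödinger operator `H` with potential `V`: the self-adjoint operator that acts by
`(Hψ)(n) = ψ(n+1) + ψ(n-1) + V(n) ψ(n)` on its natural domain, which consists of all `ψ ∈ ℓ²` for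
which the right-hand side is in `ℓ²` (all of `ℓ²` if `V` is bounded). -/
def schrodingerOp (X : Lattice) (V : ℤ → ℝ) : Ell2 X →ₗ.[ℂ] Ell2 X where
  domain :=
    { carrier := {ψ | Memℓp (diffExpr X V (ψ : X.sites → ℂ)) 2}
      add_mem' := fun {ψ φ} hψ hφ => by
        simp only [Set.mem_ofPred_eq] at hψ hφ ⊢
        rw [lp.coeFn_add, diffExpr_add]
        exact hψ.add hφ
      zero_mem' := by
        have h : diffExpr X V ((0 : Ell2 X) : X.sites → ℂ) = 0 := by
          funext n
          simp [diffExpr, zeroExt]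
        simp only [Set.mem_ofPred_eq]
        rw [h]
        exact zero_memℓp
      smul_mem' := fun c ψ hψ => by
        simp only [Set.mem_ofPred_eq] at hψ ⊢
        rw [lp.coeFn_smul, diffExpr_smul]
        exact hψ.const_smul c }
  toFun :=
    { toFun := fun ψ => ⟨diffExpr X V ((ψ : Ell2 X) : X.sites → ℂ), ψ.2⟩
      map_add' := fun ψ φ => by
        apply lp.ext
        exact diffExpr_add X V _ _
      map_smul' := fun c ψ => by
        apply lp.ext
        exact diffExpr_smul X V c _ }

/-! ### Dynamics and Borel transform -/

/-- `ψ` solves the Schrödinger equation `ψ' = -i H ψ` with initial state `φ`. -/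
def IsSchrodingerFlow {E : Type*} [NormedAddCommGroup E] [NormedSpace ℂ E]
    (H : E →ₗ.[ℂ] E) (φ : E) (ψ : ℝ → E) : Prop :=
  ψ 0 = φ ∧ ∀ t : ℝ, ∃ h : ψ t ∈ H.domain, HasDerivAt ψ (-Complex.I • H ⟨ψ t, h⟩) t

/-- `e^{-itH} φ` for `φ` in the domain of `H`: the solution of the Schrödinger equation with
initial state `φ` (for self-adjoint `H` it exists and is unique). -/
def schrodingerEvolution {E : Type*} [NormedAddCommGroup E] [NormedSpace ℂ E]
    (H : E →ₗ.[ℂ] E) (φ : E) : ℝ → E :=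
  Classical.epsilon (IsSchrodingerFlow H φ)

/-- The resolvent `(H - z)⁻¹`: the inverse of the map `φ ↦ Hφ - zφ` from the domain of `H` to the
whole space (for self-adjoint `H` and non-real `z` this map is a bijection). -/
def resolventMap {E : Type*} [NormedAddCommGroup E] [NormedSpace ℂ E]
    (H : E →ₗ.[ℂ] E) (z : ℂ) : E → H.domain :=
  Function.invFun (fun φ : H.domain => H φ - z • (φ : E))

/-- `a(n, T) = (2/T) ∫₀^∞ e^{-2t/T} |⟨e^{-itH} δ₁, δ_n⟩|² dt`. -/
def timeAvgProb (X : Lattice) (V : ℤ → ℝ) (n : X.sites) (T : ℝ) : ℝ≥0∞ :=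
  ENNReal.ofReal (2 / T) * ∫⁻ t in Set.Ioi (0 : ℝ), ENNReal.ofReal (Real.exp (-2 * t / T) *
    ‖inner ℂ (delta X n) (schrodingerEvolution (schrodingerOp X V) (delta X X.one) t)‖ ^ 2)

/-- The time-averaged moment `⟨|X|^p_{δ₁}⟩(T) = ∑_n |n|^p a(n, T)`, as an element of `[0, ∞]`. -/
def avgMoment (X : Lattice) (V : ℤ → ℝ) (p T : ℝ) : ℝ≥0∞ :=
  ∑' n : X.sites, ENNReal.ofReal (|((n : ℤ) : ℝ)| ^ p) * timeAvgProb X V n T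

/-- The Borel transform `F(z) = ⟨(H - z)⁻¹ δ₁, δ₁⟩` (the inner product of Mathlib is linear in the
second argument). -/
def borelTransform (X : Lattice) (V : ℤ → ℝ) (z : ℂ) : ℂ :=
  inner ℂ (delta X X.one) (resolventMap (schrodingerOp X V) z (delta X X.one) : Ell2 X)

/-- `I(Δ, ν) = ν ∫_Δ (Im F(E + iν))² dE`. -/
def imIntegral (X : Lattice) (V : ℤ → ℝ) (Δ : Set ℝ) (ν : ℝ) : ℝ≥0∞ :=
  ENNReal.ofReal ν * ∫⁻ E in Δ,
    ENNReal.ofReal ((borelTransform X V ((E : ℂ) + Complex.I * (ν : ℂ))).im ^ 2)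

/-! ### Solutions of the difference equation on the right half-line -/

/-- `u` (given on the sites `0, 1, 2, …`) is a real solution of
`u(n+1) + u(n-1) + V(n) u(n) = E u(n)` for all `n ≥ 1`. For a potential on `ℤ`, each such `u` is the
restriction of exactly one solution on `ℤ`. -/
def IsSolution (V : ℤ → ℝ) (E : ℝ) (u : ℕ → ℝ) : Prop :=
  ∀ n : ℕ, 1 ≤ n → u (n + 1) + u (n - 1) + V n * u n = E * u n

/-- `|u(0)|² + |u(1)|² = 1`. -/
def IsNormalized (u : ℕ → ℝ) : Prop := u 0 ^ 2 + u 1 ^ 2 = 1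

/-- `‖u‖_L² = ∑_{n=1}^{[L]} |u(n)|² + (L - [L]) |u([L]+1)|²`, for `L ≥ 0`. -/
def normSqUpTo (u : ℕ → ℝ) (L : ℝ) : ℝ :=
  ∑ n ∈ Finset.Icc 1 ⌊L⌋₊, u n ^ 2 + (L - (⌊L⌋₊ : ℝ)) * u (⌊L⌋₊ + 1) ^ 2

/-- `‖u‖_L² ≤ C L^{2α+1}` for all `E ∈ A`, all normalized solutions `u` and all `L ≥ 1`. -/
def UpperPowerBound (V : ℤ → ℝ) (A : Set ℝ) (C α : ℝ) : Prop :=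
  ∀ E ∈ A, ∀ u : ℕ → ℝ, IsSolution V E u → IsNormalized u →
    ∀ L : ℝ, 1 ≤ L → normSqUpTo u L ≤ C * L ^ (2 * α + 1)

/-- `‖u‖_L² ≥ (1 + γ) ‖u‖_{kL}²` for all `E ∈ A`, all solutions `u` and all `L ≥ L₀`. -/
def ScalingLowerBound (V : ℤ → ℝ) (A : Set ℝ) (k γ L₀ : ℝ) : Prop :=
  ∀ E ∈ A, ∀ u : ℕ → ℝ, IsSolution V E u →
    ∀ L : ℝ, L₀ ≤ L → (1 + γ) * normSqUpTo u (k * L) ≤ normSqUpTo u L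

/-- `‖u‖_L ≥ D L^κ` for all `E ∈ A`, all normalized solutions `u` and all `L ≥ L₁`. -/
def LowerPowerBound (V : ℤ → ℝ) (A : Set ℝ) (D κ L₁ : ℝ) : Prop :=
  ∀ E ∈ A, ∀ u : ℕ → ℝ, IsSolution V E u → IsNormalized u →
    ∀ L : ℝ, L₁ ≤ L → D * L ^ κ ≤ √(normSqUpTo u L)

end Schrodinger1D

end

open Schrodinger1D

/-!
Along a horizontal line the Green function `G(E + iε; n, 1)` is the Laplace transform of
`⟨e^{-itH} δ₁, δ_n⟩`, so by Plancherel `a(n, T) = (1 / (πT)) ∫ |G(E + iε; n, 1)|² dE` with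
`ε = 1/T`. On the sites `n ≥ 1` the Green function, with its value at `0` lowered by `1`, solves the
difference equation at the energy `E + iε` and equals `F` at the site `1`. For an energy `E' ∈ A`
near `E` it is compared, by variation of parameters, with the solution at energy `E'` having the
same initial data. That solution has mass at least `|F|²` times the least mass of a normalized real
solution, which is bounded below by (c), and also by (a) together with the Gram determinant of the
two standard solutions; the same determinant controls the error of the comparison. The length `L` is
chosen so that the determinant makes this error harmless: (c) makes the determinant large enough for
such an `L` to exist, and (a) forces `L ≥ (γT / (72C))^{1/(2α+1)}`. The scaling bound (b) then puts
a fixed proportion of the mass into the annulus `kL < n ≤ L`, and the three bounds are lower bounds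
for the resulting expression over all admissible `L`.
-/

namespace Schrodinger1D

open MeasureTheory FourierTransform Filter Topology ComplexConjugate

noncomputable section

/-! ### Plancherel's identity and the Laplace transform -/

section Laplace

section Plancherel

variable {V F : Type*} [NormedAddCommGroup V] [InnerProductSpace ℝ V] [FiniteDimensional ℝ V]
  [MeasurableSpace V] [BorelSpace V] [NormedAddCommGroup F] [InnerProductSpace ℂ F]
  [CompleteSpace F]

theorem fourier_toLp_ae_eq {f : V → F} (h1 : Integrable f) (h2 : MemLp f 2) :
    (𝓕 (h2.toLp f) : Lp F 2 (volume : Measure V)) =ᵐ[volume] 𝓕 f := by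
  have hcont : Continuous (𝓕 f) :=
    VectorFourier.fourierIntegral_continuous Real.continuous_fourierChar continuous_inner h1
  refine ae_eq_of_integral_contDiff_smul_eq ((Lp.memLp _).locallyIntegrable one_le_two)
    hcont.locallyIntegrable fun g hg hgs => ?_
  have hsupp : HasCompactSupport (Complex.ofRealCLM ∘ g) := hgs.comp_left rfl
  have hsmooth : ContDiff ℝ (⊤ : ℕ∞) (Complex.ofRealCLM ∘ g) := Complex.ofRealCLM.contDiff.comp hg
  set φ := hsupp.toSchwartzMap hsmooth with hφ
  have real_smul (h : V → F) : ∫ x, g x • h x = ∫ x, φ x • h x :=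
    integral_congr_ae (ae_of_all _ fun x => by simp [hφ])
  have weak := congrArg (fun S => S φ) (Lp.fourier_toTemperedDistribution_eq (h2.toLp f))
  simp only [TemperedDistribution.fourier_apply, Lp.toTemperedDistribution_apply] at weak
  calc ∫ x, g x • (𝓕 (h2.toLp f) : Lp F 2 (volume : Measure V)) x
      = ∫ x, (𝓕 φ) x • (h2.toLp f : Lp F 2 (volume : Measure V)) x := by rw [real_smul, ← weak]
    _ = ∫ x, (𝓕 φ) x • f x := by
        refine integral_congr_ae ?_
        filter_upwards [h2.coeFn_toLp] with x hx
        rw [hx]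
    _ = ∫ x, φ x • 𝓕 f x := by
        have flip := VectorFourier.integral_fourierIntegral_smul_eq_flip (L := innerₗ V)
          (μ := volume) (ν := volume) Real.continuous_fourierChar continuous_inner φ.integrable h1
        simpa [SchwartzMap.fourier_coe] using! flip
    _ = ∫ x, g x • 𝓕 f x := (real_smul _).symm

theorem lintegral_enorm_fourier_sq {f : V → F} (h1 : Integrable f) (h2 : MemLp f 2) :
    ∫⁻ ξ, ‖𝓕 f ξ‖ₑ ^ 2 = ∫⁻ x, ‖f x‖ₑ ^ 2 := by
  have lintegral_sq (g : V → F) : ∫⁻ x, ‖g x‖ₑ ^ 2 = eLpNorm g 2 volume ^ 2 := by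
    simpa using (eLpNorm_nnreal_pow_eq_lintegral (f := g) (μ := volume) two_ne_zero).symm
  have isometry := Lp.norm_fourier_eq (h2.toLp f)
  rw [Lp.norm_def, Lp.norm_def, ENNReal.toReal_eq_toReal_iff' (Lp.eLpNorm_ne_top _)
    (Lp.eLpNorm_ne_top _), eLpNorm_congr_ae (fourier_toLp_ae_eq h1 h2),
    eLpNorm_congr_ae h2.coeFn_toLp] at isometry
  rw [lintegral_sq, lintegral_sq, isometry]

end Plancherel

section NormedSpace

variable {F : Type*} [NormedAddCommGroup F] [NormedSpace ℂ F]

/-- The Laplace transform `∫₀^∞ e^{izt} f(t) dt` in the convention in which it converges for bounded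
`f` and `Im z > 0`; the Green function is the transform of the Schrödinger evolution. -/
def laplace (f : ℝ → F) (z : ℂ) : F :=
  ∫ t in Set.Ioi (0 : ℝ), Complex.exp (Complex.I * z * t) • f t

/-- The integrand of the Laplace transform at `z`, extended by zero to the whole line, so that its
Fourier transform is a Laplace transform along a horizontal line. -/
def damped (f : ℝ → F) (z : ℂ) : ℝ → F :=
  (Set.Ioi (0 : ℝ)).indicator fun t : ℝ => Complex.exp (Complex.I * z * t) • f t

variable {f : ℝ → F} {z : ℂ} {ε K : ℝ}

theorem norm_exp_I_mul_mul (z : ℂ) (t : ℝ) :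
    ‖Complex.exp (Complex.I * z * t)‖ = Real.exp (-z.im * t) := by
  simp [Complex.norm_exp]

theorem norm_damped_le (hK : ∀ t, ‖f t‖ ≤ K) (hz : 0 < z.im) (t : ℝ) : ‖damped f z t‖ ≤ K := by
  by_cases ht : t ∈ Set.Ioi (0 : ℝ)
  · rw [damped, Set.indicator_of_mem ht, norm_smul, norm_exp_I_mul_mul]
    refine (mul_le_of_le_one_left (norm_nonneg _) (Real.exp_le_one_iff.2 ?_)).trans (hK t)
    exact mul_nonpos_of_nonpos_of_nonneg (neg_nonpos.2 hz.le) (le_of_lt ht)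
  · rw [damped, Set.indicator_of_notMem ht, norm_zero]
    exact (norm_nonneg _).trans (hK t)

theorem integrableOn_exp_smul (hf : Continuous f) (hK : ∀ t, ‖f t‖ ≤ K) (hz : 0 < z.im) :
    IntegrableOn (fun t : ℝ => Complex.exp (Complex.I * z * t) • f t) (Set.Ioi 0) := by
  refine ((exp_neg_integrableOn_Ioi 0 hz).mul_const K).mono' (by fun_prop) (ae_of_all _ fun t => ?_)
  rw [norm_smul, norm_exp_I_mul_mul]
  exact mul_le_mul_of_nonneg_left (hK t) (Real.exp_nonneg _)

theorem integrable_damped (hf : Continuous f) (hK : ∀ t, ‖f t‖ ≤ K) (hz : 0 < z.im) :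
    Integrable (damped f z) :=
  (integrableOn_exp_smul hf hK hz).integrable_indicator measurableSet_Ioi

theorem memLp_two_damped (hf : Continuous f) (hK : ∀ t, ‖f t‖ ≤ K) (hz : 0 < z.im) :
    MemLp (damped f z) 2 := by
  have hint := integrable_damped hf hK hz
  rw [memLp_two_iff_integrable_sq_norm hint.aestronglyMeasurable]
  refine (hint.norm.mul_const K).mono' (hint.aestronglyMeasurable.norm.pow 2)
    (ae_of_all _ fun t => ?_)
  rw [norm_pow, norm_norm, sq]
  exact mul_le_mul_of_nonneg_left (norm_damped_le hK hz t) (norm_nonneg _)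

theorem laplace_eq_fourier (f : ℝ → F) (ε E : ℝ) :
    laplace f (E + Complex.I * ε) = 𝓕 (damped f (Complex.I * ε)) (-(2 * Real.pi)⁻¹ * E) := by
  rw [laplace, Real.fourier_real_eq_integral_exp_smul, ← integral_indicator measurableSet_Ioi]
  congr 1 with t
  by_cases ht : t ∈ Set.Ioi (0 : ℝ)
  · rw [damped, Set.indicator_of_mem ht, Set.indicator_of_mem ht, smul_smul, ← Complex.exp_add]
    have hpi : (Real.pi : ℂ) ≠ 0 := by exact_mod_cast Real.pi_ne_zero
    congr 2
    push_cast
    field_simp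
  · rw [damped, Set.indicator_of_notMem ht, Set.indicator_of_notMem ht, smul_zero]

theorem continuous_fourier_damped (hf : Continuous f) (hK : ∀ t, ‖f t‖ ≤ K) (hz : 0 < z.im) :
    Continuous (𝓕 (damped f z)) :=
  VectorFourier.fourierIntegral_continuous Real.continuous_fourierChar continuous_inner
    (integrable_damped hf hK hz)

theorem continuous_laplace (hf : Continuous f) (hK : ∀ t, ‖f t‖ ≤ K) (hε : 0 < ε) :
    Continuous fun E : ℝ => laplace f (E + Complex.I * ε) := by
  simp_rw [laplace_eq_fourier]
  exact (continuous_fourier_damped hf hK (by simpa using hε)).comp (by fun_prop)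

theorem laplace_clm_comp {G : Type*} [CompleteSpace F] [NormedAddCommGroup G] [NormedSpace ℂ G]
    [CompleteSpace G] (L : F →L[ℂ] G) (hf : Continuous f) (hK : ∀ t, ‖f t‖ ≤ K) (hz : 0 < z.im) :
    laplace (fun t => L (f t)) z = L (laplace f z) := by
  rw [laplace, laplace, ← L.integral_comp_comm (integrableOn_exp_smul hf hK hz)]
  simp only [map_smul]

end NormedSpace

theorem lintegral_enorm_laplace_sq {F : Type*} [NormedAddCommGroup F] [InnerProductSpace ℂ F]
    [CompleteSpace F] {f : ℝ → F} {ε K : ℝ} (hf : Continuous f) (hK : ∀ t, ‖f t‖ ≤ K)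
    (hε : 0 < ε) :
    ∫⁻ E : ℝ, ‖laplace f (E + Complex.I * ε)‖ₑ ^ 2 = ENNReal.ofReal (2 * Real.pi) *
      ∫⁻ t in Set.Ioi (0 : ℝ), ENNReal.ofReal (Real.exp (-2 * ε * t) * ‖f t‖ ^ 2) := by
  have hz : 0 < (Complex.I * ε).im := by simpa using hε
  have hcont := continuous_fourier_damped hf hK hz
  have hscale : (-(2 * Real.pi)⁻¹ : ℝ) ≠ 0 := by simp [Real.pi_ne_zero]
  calc ∫⁻ E : ℝ, ‖laplace f (E + Complex.I * ε)‖ₑ ^ 2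
      = ∫⁻ E : ℝ, ‖𝓕 (damped f (Complex.I * ε)) (-(2 * Real.pi)⁻¹ * E)‖ₑ ^ 2 := by
        simp_rw [laplace_eq_fourier]
    _ = ENNReal.ofReal |(-(2 * Real.pi)⁻¹)⁻¹| * ∫⁻ ξ, ‖𝓕 (damped f (Complex.I * ε)) ξ‖ₑ ^ 2 := by
        rw [← lintegral_map (f := fun ξ => ‖𝓕 (damped f (Complex.I * ε)) ξ‖ₑ ^ 2)
          (hcont.enorm.measurable.pow_const 2) (measurable_const_mul _),
          Real.map_volume_mul_left hscale, lintegral_smul_measure, smul_eq_mul]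
    _ = ENNReal.ofReal (2 * Real.pi) * ∫⁻ t, ‖damped f (Complex.I * ε) t‖ₑ ^ 2 := by
        rw [lintegral_enorm_fourier_sq (integrable_damped hf hK hz) (memLp_two_damped hf hK hz),
          inv_neg, inv_inv, abs_neg, abs_of_pos Real.two_pi_pos]
    _ = _ := by
        rw [← lintegral_indicator measurableSet_Ioi]
        congr 2 with t
        by_cases ht : t ∈ Set.Ioi (0 : ℝ)
        · rw [damped, Set.indicator_of_mem ht, Set.indicator_of_mem ht, ← ofReal_norm, norm_smul,
            norm_exp_I_mul_mul, ← ENNReal.ofReal_pow (by positivity), mul_pow, ← Real.exp_nat_mul]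
          congr 3
          simp
          ring
        · simp [damped, Set.indicator_of_notMem ht]

end Laplace

/-! ### Zero extension and Green's identity -/

section GreenIdentity

variable {X : Lattice}

theorem memℓp_two_iff {ι : Type*} {f : ι → ℂ} : Memℓp f 2 ↔ Summable fun i => ‖f i‖ ^ 2 := by
  rw [memℓp_gen_iff (by norm_num)]; simp

theorem zeroExt_coe (ψ : X.sites → ℂ) (n : X.sites) : zeroExt ψ n = ψ n := by
  simp [zeroExt]

theorem zeroExt_of_notMem (ψ : X.sites → ℂ) {n : ℤ} (hn : n ∉ X.sites) : zeroExt ψ n = 0 := by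
  simp [zeroExt, hn]

theorem summable_sq_zeroExt (ψ : Ell2 X) (m : ℤ) :
    Summable fun n : ℤ => ‖zeroExt ψ (n + m)‖ ^ 2 := by
  refine Summable.comp_injective (f := fun n : ℤ => ‖zeroExt (ψ : X.sites → ℂ) n‖ ^ 2) ?_
    (add_left_injective m)
  rw [← (Subtype.val_injective (p := (· ∈ X.sites))).summable_iff]
  · simpa only [Function.comp_def, zeroExt_coe] using memℓp_two_iff.1 (lp.memℓp ψ)
  · intro n hn
    have hn' : n ∉ X.sites := fun h => hn ⟨⟨n, h⟩, rfl⟩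
    simp [zeroExt_of_notMem _ hn']

theorem summable_conj_mul_of_summable_sq {ι : Type*} {f g : ι → ℂ}
    (hf : Summable fun i => ‖f i‖ ^ 2) (hg : Summable fun i => ‖g i‖ ^ 2) :
    Summable fun i => conj (f i) * g i := by
  refine Summable.of_norm_bounded (hf.add hg) fun i => ?_
  rw [norm_mul, RCLike.norm_conj]
  nlinarith [sq_nonneg (‖f i‖ - ‖g i‖), norm_nonneg (f i), norm_nonneg (g i)]

theorem tsum_sub_shift_eq_zero {W : ℤ → ℂ} (hW : Summable W) :
    ∑' n : ℤ, (W n - W (n - 1)) = 0 := by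
  have hshift : Summable fun n => W (n - 1) := hW.comp_injective sub_left_injective
  rw [hW.tsum_sub hshift, sub_eq_zero]
  exact ((Equiv.subRight (1 : ℤ)).tsum_eq W).symm

/-- The Wronskian `conj ψ(n+1) φ(n) - conj ψ(n) φ(n+1)` of `conj ψ` and `φ`, whose increments are
the summands of the boundary form `⟨Hψ, φ⟩ - ⟨ψ, Hφ⟩`. -/
def boundaryForm (ψ φ : X.sites → ℂ) (n : ℤ) : ℂ :=
  conj (zeroExt ψ (n + 1)) * zeroExt φ n - conj (zeroExt ψ n) * zeroExt φ (n + 1)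

theorem summable_boundaryForm (ψ φ : Ell2 X) : Summable (boundaryForm ψ φ) :=
  have summable_sq (χ : Ell2 X) : Summable fun n : ℤ => ‖zeroExt χ n‖ ^ 2 := by
    simpa using summable_sq_zeroExt χ 0
  (summable_conj_mul_of_summable_sq (summable_sq_zeroExt ψ 1) (summable_sq φ)).sub
    (summable_conj_mul_of_summable_sq (summable_sq ψ) (summable_sq_zeroExt φ 1))

theorem inner_diffExpr_sub_inner_diffExpr (V : ℤ → ℝ) (ψ φ : X.sites → ℂ) (n : X.sites) :
    inner ℂ (diffExpr X V ψ n) (φ n) - inner ℂ (ψ n) (diffExpr X V φ n)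
      = boundaryForm ψ φ n - boundaryForm ψ φ (n - 1) := by
  simp only [diffExpr, RCLike.inner_apply, boundaryForm, sub_add_cancel, map_add, map_mul,
    Complex.conj_ofReal, zeroExt_coe]
  ring

theorem inner_eq_inner_of_eq_diffExpr (V : ℤ → ℝ) {ψ φ ψ' φ' : Ell2 X}
    (hψ : (ψ' : X.sites → ℂ) = diffExpr X V ψ) (hφ : (φ' : X.sites → ℂ) = diffExpr X V φ) :
    inner ℂ ψ' φ = inner ℂ ψ φ' := by
  have hsupp : (fun n : ℤ => boundaryForm ψ φ n - boundaryForm ψ φ (n - 1)).support ⊆ X.sites := by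
    refine fun n hn => by_contra fun h => hn ?_
    simp [boundaryForm, zeroExt_of_notMem _ h]
  rw [← sub_eq_zero,
    ← ((lp.hasSum_inner (𝕜 := ℂ) ψ' φ).sub (lp.hasSum_inner (𝕜 := ℂ) ψ φ')).tsum_eq]
  calc _ = ∑' n : X.sites, (boundaryForm ψ φ n - boundaryForm ψ φ (n - 1)) :=
        tsum_congr fun n => by rw [hψ, hφ, inner_diffExpr_sub_inner_diffExpr]
    _ = ∑' n : ℤ, (boundaryForm ψ φ n - boundaryForm ψ φ (n - 1)) :=
        tsum_subtype_eq_of_support_subset hsupp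
    _ = 0 := tsum_sub_shift_eq_zero (summable_boundaryForm ψ φ)

theorem schrodingerOp_isFormalAdjoint_self (X : Lattice) (V : ℤ → ℝ) :
    (schrodingerOp X V).IsFormalAdjoint (schrodingerOp X V) :=
  fun _ _ => inner_eq_inner_of_eq_diffExpr V rfl rfl

end GreenIdentity

/-! ### Truncated potentials -/

section Cutoff

variable {X : Lattice} {V : ℤ → ℝ} {N M : ℕ}

/-- The potential `V` restricted to the sites `|n| ≤ N`. It makes the operator bounded without
changing its action on functions supported there. -/
def cutoff (V : ℤ → ℝ) (N : ℕ) (n : ℤ) : ℝ := if |n| ≤ N then V n else 0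

/-- The function `ψ` vanishes at all sites with `|n| > N`. -/
def SupportedIn (N : ℕ) (ψ : X.sites → ℂ) : Prop := ∀ n : X.sites, (N : ℤ) < |(n : ℤ)| → ψ n = 0

theorem SupportedIn.mono {ψ : X.sites → ℂ} (hψ : SupportedIn M ψ) (h : M ≤ N) : SupportedIn N ψ :=
  fun n hn => hψ n (lt_of_le_of_lt (by exact_mod_cast h) hn)

theorem SupportedIn.zeroExt_eq_zero {ψ : X.sites → ℂ} (hψ : SupportedIn N ψ) {n : ℤ}
    (hn : (N : ℤ) < |n|) : zeroExt ψ n = 0 := by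
  by_cases h : n ∈ X.sites
  · simpa [zeroExt, h] using hψ ⟨n, h⟩ hn
  · exact zeroExt_of_notMem ψ h

theorem SupportedIn.supportedIn_diffExpr {ψ : X.sites → ℂ} (hψ : SupportedIn N ψ) :
    SupportedIn (N + 1) (diffExpr X V ψ) := by
  intro n hn
  push_cast at hn
  rw [diffExpr, hψ.zeroExt_eq_zero (by grind), hψ.zeroExt_eq_zero (by grind),
    hψ n (by grind)]
  simp

theorem SupportedIn.diffExpr_cutoff {ψ : X.sites → ℂ} (hψ : SupportedIn N ψ) :
    diffExpr X (cutoff V N) ψ = diffExpr X V ψ := by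
  funext n
  rcases le_or_gt |(n : ℤ)| N with h | h
  · simp [diffExpr, cutoff, h]
  · simp [diffExpr, hψ n h]

theorem supportedIn_delta (n : X.sites) : SupportedIn (n : ℤ).natAbs (delta X n : X.sites → ℂ) := by
  intro m hm
  rw [delta, lp.single_apply_ne]
  rintro rfl
  simp at hm

theorem inner_delta (n : X.sites) (ψ : Ell2 X) : inner ℂ (delta X n) ψ = ψ n := by
  rw [delta, lp.inner_single_left]
  simp

theorem memℓp_diffExpr_cutoff (V : ℤ → ℝ) (N : ℕ) (ψ : Ell2 X) :
    Memℓp (diffExpr X (cutoff V N) (ψ : X.sites → ℂ)) 2 := by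
  have hinj : Function.Injective (fun n : X.sites => (n : ℤ)) := Subtype.val_injective
  have hshift (m : ℤ) : Memℓp (fun n : X.sites => zeroExt (ψ : X.sites → ℂ) (n + m)) 2 :=
    memℓp_two_iff.2 ((summable_sq_zeroExt ψ m).comp_injective hinj)
  have hpot : Memℓp (fun n : X.sites => (cutoff V N n : ℂ) * (ψ : X.sites → ℂ) n) 2 := by
    rw [memℓp_two_iff]
    refine summable_of_hasFiniteSupport
      (((Set.finite_Icc (-(N : ℤ)) N).preimage hinj.injOn).subset fun n hn => by_contra fun h => ?_)
    have : ¬|(n : ℤ)| ≤ N := by rwa [abs_le]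
    exact hn (by simp [cutoff, this])
  exact ((hshift 1).add (hshift (-1))).add hpot

/-- The Schrödinger operator with truncated potential, which is defined on the whole space. -/
def cutoffOp (X : Lattice) (V : ℤ → ℝ) (N : ℕ) : Ell2 X →ₗ[ℂ] Ell2 X where
  toFun ψ := ⟨diffExpr X (cutoff V N) ψ, memℓp_diffExpr_cutoff V N ψ⟩
  map_add' _ _ := lp.ext (diffExpr_add X _ _ _)
  map_smul' c _ := lp.ext (diffExpr_smul X _ c _)

theorem coe_cutoffOp (ψ : Ell2 X) :
    (cutoffOp X V N ψ : X.sites → ℂ) = diffExpr X (cutoff V N) ψ := rfl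

theorem cutoffOp_isSymmetric (X : Lattice) (V : ℤ → ℝ) (N : ℕ) : (cutoffOp X V N).IsSymmetric :=
  fun _ _ => inner_eq_inner_of_eq_diffExpr (cutoff V N) rfl rfl

theorem cutoffOp_eq_of_supportedIn {ψ : Ell2 X} (hψ : SupportedIn M (ψ : X.sites → ℂ))
    (h : M ≤ N) : cutoffOp X V N ψ = cutoffOp X V M ψ :=
  lp.ext ((hψ.mono h).diffExpr_cutoff.trans hψ.diffExpr_cutoff.symm)

theorem delta_mem_domain (V : ℤ → ℝ) (n : X.sites) : delta X n ∈ (schrodingerOp X V).domain := by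
  change Memℓp (diffExpr X V (delta X n : X.sites → ℂ)) 2
  rw [← (supportedIn_delta n).diffExpr_cutoff]
  exact memℓp_diffExpr_cutoff V _ _

theorem inner_schrodingerOp_delta (V : ℤ → ℝ) (n : X.sites) (ψ : Ell2 X) :
    inner ℂ (schrodingerOp X V ⟨delta X n, delta_mem_domain V n⟩) ψ = diffExpr X V ψ n := by
  have hcut : schrodingerOp X V ⟨delta X n, delta_mem_domain V n⟩
      = cutoffOp X V (n : ℤ).natAbs (delta X n) :=
    lp.ext (supportedIn_delta n).diffExpr_cutoff.symm
  rw [hcut, cutoffOp_isSymmetric, inner_delta, coe_cutoffOp]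
  simp [diffExpr, cutoff]

theorem tendsto_zeroExt {ι : Type*} {l : Filter ι} {F : ι → X.sites → ℂ} {f : X.sites → ℂ}
    (h : ∀ n, Tendsto (fun i => F i n) l (𝓝 (f n))) (m : ℤ) :
    Tendsto (fun i => zeroExt (F i) m) l (𝓝 (zeroExt f m)) := by
  by_cases hm : m ∈ X.sites
  · simpa only [zeroExt, hm, dif_pos] using h ⟨m, hm⟩
  · simpa only [zeroExt_of_notMem _ hm] using tendsto_const_nhds

theorem tendsto_cutoff (V : ℤ → ℝ) (n : ℤ) : Tendsto (fun N => cutoff V N n) atTop (𝓝 (V n)) := by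
  refine tendsto_const_nhds.congr' ?_
  filter_upwards [eventually_ge_atTop n.natAbs] with N hN
  rw [cutoff, if_pos (by rw [Int.abs_eq_natAbs]; exact_mod_cast hN)]

theorem tendsto_diffExpr_cutoff {ι : Type*} {l : Filter ι} {N : ι → ℕ} (hN : Tendsto N l atTop)
    {F : ι → X.sites → ℂ} {f : X.sites → ℂ} (h : ∀ n, Tendsto (fun i => F i n) l (𝓝 (f n)))
    (n : X.sites) :
    Tendsto (fun i => diffExpr X (cutoff V (N i)) (F i) n) l (𝓝 (diffExpr X V f n)) := by
  have hV : Tendsto (fun i => (cutoff V (N i) n : ℂ)) l (𝓝 (V n : ℂ)) :=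
    (Complex.continuous_ofReal.tendsto _).comp ((tendsto_cutoff V n).comp hN)
  exact ((tendsto_zeroExt h _).add (tendsto_zeroExt h _)).add (hV.mul (h n))

end Cutoff

/-! ### Schrödinger flows -/

section Flow

variable {E : Type*} [NormedAddCommGroup E] [InnerProductSpace ℂ E]

theorem IsSchrodingerFlow.continuous {H : E →ₗ.[ℂ] E} {φ : E} {ψ : ℝ → E}
    (h : IsSchrodingerFlow H φ ψ) : Continuous ψ :=
  continuous_iff_continuousAt.2 fun t => (h.2 t).choose_spec.continuousAt

theorem IsSchrodingerFlow.norm_eq {H : E →ₗ.[ℂ] E} (hH : H.IsFormalAdjoint H) {φ : E} {ψ : ℝ → E}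
    (h : IsSchrodingerFlow H φ ψ) (t : ℝ) : ‖ψ t‖ = ‖φ‖ := by
  have hder (s : ℝ) : HasDerivAt (fun s => inner ℂ (ψ s) (ψ s)) 0 s := by
    obtain ⟨hs, hds⟩ := h.2 s
    convert! hds.inner ℂ hds using 1
    rw [inner_smul_left, inner_smul_right, hH ⟨ψ s, hs⟩ ⟨ψ s, hs⟩]
    simp
  have hconst := is_const_of_deriv_eq_zero (fun s => (hder s).differentiableAt)
    (fun s => (hder s).deriv) t 0
  simp only [h.1, inner_self_eq_norm_sq_to_K] at hconst
  have hsq : ‖ψ t‖ ^ 2 = ‖φ‖ ^ 2 := by exact_mod_cast hconst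
  exact (pow_left_inj₀ (norm_nonneg _) (norm_nonneg _) two_ne_zero).1 hsq

theorem hasDerivAt_of_norm_sub_le_sq {F : Type*} [NormedAddCommGroup F] [NormedSpace ℝ F]
    {ψ : ℝ → F} {d : F} {s K : ℝ}
    (h : ∀ t, ‖ψ t - ψ s - (t - s) • d‖ ≤ K * (t - s) ^ 2) : HasDerivAt ψ d s := by
  rw [hasDerivAt_iff_isLittleO]
  have hO : (fun t => ψ t - ψ s - (t - s) • d) =O[𝓝 s] fun t => (t - s) ^ 2 :=
    Asymptotics.IsBigO.of_bound K (Eventually.of_forall fun t => by simpa using h t)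
  have hsub : Tendsto (fun t : ℝ => t - s) (𝓝 s) (𝓝 0) := by
    simpa using (continuous_id.sub continuous_const).tendsto (f := fun t : ℝ => t - s) s
  refine hO.trans_isLittleO ?_
  simpa [pow_two] using! ((Asymptotics.isLittleO_one_iff ℝ).2 hsub).mul_isBigO
    (Asymptotics.isBigO_refl (fun t : ℝ => t - s) (𝓝 s))

theorem norm_sub_sub_smul_le_of_hasDerivAt {F : Type*} [NormedAddCommGroup F] [NormedSpace ℝ F]
    {u u' : ℝ → F} {K : ℝ} (hu : ∀ t, HasDerivAt u (u' t) t)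
    (hu' : ∀ s t, ‖u' t - u' s‖ ≤ K * |t - s|) (s t : ℝ) :
    ‖u t - u s - (t - s) • u' s‖ ≤ K * (t - s) ^ 2 := by
  have hder (τ : ℝ) : HasDerivAt (fun τ => u τ - (τ - s) • u' s) (u' τ - u' s) τ := by
    simpa using! (hu τ).sub (((hasDerivAt_id τ).sub_const s).smul_const (u' s))
  have hK : 0 ≤ K := by simpa using (norm_nonneg _).trans (hu' 0 1)
  have hbound (τ : ℝ) (hτ : τ ∈ Set.uIcc s t) : ‖u' τ - u' s‖ ≤ K * |t - s| :=
    (hu' s τ).trans (mul_le_mul_of_nonneg_left (Set.abs_sub_left_of_mem_uIcc hτ) hK)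
  have hmean := (convex_uIcc s t).norm_image_sub_le_of_norm_hasDerivWithin_le
    (fun τ _ => (hder τ).hasDerivWithinAt) hbound Set.left_mem_uIcc Set.right_mem_uIcc
  rw [sub_self, zero_smul, sub_zero, Real.norm_eq_abs, mul_assoc, abs_mul_abs_self,
    ← pow_two] at hmean
  rwa [sub_right_comm]

/-- The one-parameter group `e^{-itB}` of a bounded operator. -/
def expFlow (B : E →L[ℂ] E) (t : ℝ) : E →L[ℂ] E := NormedSpace.exp (t • (-Complex.I • B))

variable [CompleteSpace E] (B : E →L[ℂ] E)

theorem apply_expFlow_apply (t : ℝ) (w : E) : B (expFlow B t w) = expFlow B t (B w) :=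
  have hcomm : Commute B (expFlow B t) :=
    (((Commute.refl B).smul_right (-Complex.I)).smul_right t).exp_right
  congrArg (fun S : E →L[ℂ] E => S w) hcomm.eq

theorem hasDerivAt_expFlow_apply (w : E) (t : ℝ) :
    HasDerivAt (fun τ => expFlow B τ w) (-Complex.I • B (expFlow B t w)) t := by
  have h := ((ContinuousLinearMap.apply ℂ E w).restrictScalars ℝ).hasFDerivAt.comp_hasDerivAt t
    (hasDerivAt_exp_smul_const (-Complex.I • B) t)
  rw [apply_expFlow_apply, ← map_smul]
  exact h

theorem isSchrodingerFlow_expFlow (w : E) :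
    IsSchrodingerFlow ((B : E →ₗ[ℂ] E).toPMap ⊤) w fun t => expFlow B t w :=
  ⟨by simp [expFlow], fun t => ⟨Submodule.mem_top, hasDerivAt_expFlow_apply B w t⟩⟩

variable {B}

theorem norm_expFlow_apply (hB : (B : E →ₗ[ℂ] E).IsSymmetric) (t : ℝ) (w : E) :
    ‖expFlow B t w‖ = ‖w‖ :=
  (isSchrodingerFlow_expFlow B w).norm_eq (fun x y => hB x y) t

theorem norm_expFlow_apply_sub_le (hB : (B : E →ₗ[ℂ] E).IsSymmetric) (w : E) (s t : ℝ) :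
    ‖expFlow B t w - expFlow B s w‖ ≤ ‖B w‖ * |t - s| := by
  refine convex_univ.norm_image_sub_le_of_norm_hasDerivWithin_le
    (fun τ _ => (hasDerivAt_expFlow_apply B w τ).hasDerivWithinAt)
    (fun τ _ => ?_) (Set.mem_univ s) (Set.mem_univ t)
  rw [apply_expFlow_apply, norm_smul, norm_expFlow_apply hB]
  simp

theorem norm_expFlow_apply_sub_sub_smul_le (hB : (B : E →ₗ[ℂ] E).IsSymmetric) (w : E) (s t : ℝ) :
    ‖expFlow B t w - expFlow B s w - (t - s) • (-Complex.I • B (expFlow B s w))‖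
      ≤ ‖B (B w)‖ * (t - s) ^ 2 := by
  refine norm_sub_sub_smul_le_of_hasDerivAt (hasDerivAt_expFlow_apply B w) (fun s t => ?_) s t
  rw [← smul_sub, norm_smul, apply_expFlow_apply, apply_expFlow_apply]
  simpa using norm_expFlow_apply_sub_le hB (B w) s t

end Flow

/-! ### Existence of the Schrödinger flow -/

theorem exists_lp_tendsto_apply {ι α : Type*} {E : α → Type*} [∀ i, NormedAddCommGroup (E i)]
    [∀ i, ProperSpace (E i)] {p : ℝ≥0∞} [Fact (1 ≤ p)] (l : Ultrafilter ι) {F : ι → lp E p} {K : ℝ}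
    (hF : ∀ i, ‖F i‖ ≤ K) : ∃ f : lp E p, ∀ n, Tendsto (fun i => F i n) l (𝓝 (f n)) := by
  have hlim (n : α) : ∃ x : E n, Tendsto (fun i => F i n) l (𝓝 x) := by
    have hp : p ≠ 0 := (zero_lt_one.trans_le Fact.out).ne'
    obtain ⟨x, -, hx⟩ := (isCompact_closedBall (0 : E n) K).ultrafilter_le_nhds
      (l.map fun i => F i n) (le_principal_iff.2 <| Eventually.of_forall (f := (l : Filter ι))
        fun i => mem_closedBall_zero_iff.2 ((lp.norm_apply_le_norm hp _ _).trans (hF i)))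
    exact ⟨x, hx⟩
  choose f hf using hlim
  have hbdd : Bornology.IsBounded (Set.range F) :=
    isBounded_iff_forall_norm_le.2 ⟨K, Set.forall_mem_range.2 hF⟩
  exact ⟨⟨f, lp.memℓp_of_tendsto hbdd (tendsto_pi_nhds.2 hf)⟩, hf⟩

section Existence

variable {X : Lattice} {V : ℤ → ℝ}

theorem exists_isSchrodingerFlow_of_tendsto {φ : Ell2 X} {K K' K'' : ℝ}
    {ι : Type*} (l : Ultrafilter ι) {N : ι → ℕ} (hN : Tendsto N l atTop) {u : ι → ℝ → Ell2 X}
    (h0 : ∀ i, u i 0 = φ) (hu : ∀ i t, ‖u i t‖ ≤ K)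
    (hHu : ∀ i t, ‖cutoffOp X V (N i) (u i t)‖ ≤ K')
    (hu' : ∀ i s t, ‖u i t - u i s - (t - s) • (-Complex.I • cutoffOp X V (N i) (u i s))‖
      ≤ K'' * (t - s) ^ 2) :
    ∃ ψ, IsSchrodingerFlow (schrodingerOp X V) φ ψ := by
  choose ψ hψ using fun t => exists_lp_tendsto_apply l fun i => hu i t
  choose η hη using fun t => exists_lp_tendsto_apply l fun i => hHu i t
  have hHψ (t : ℝ) : (η t : X.sites → ℂ) = diffExpr X V (ψ t) :=
    funext fun n => tendsto_nhds_unique (hη t n) (tendsto_diffExpr_cutoff hN (hψ t) n)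
  have hmem (t : ℝ) : ψ t ∈ (schrodingerOp X V).domain := by
    change Memℓp (diffExpr X V (ψ t : X.sites → ℂ)) 2
    exact hHψ t ▸ lp.memℓp (η t)
  refine ⟨ψ, lp.ext (funext fun n => tendsto_nhds_unique (hψ 0 n) ?_), fun s => ⟨hmem s, ?_⟩⟩
  · simpa only [h0] using tendsto_const_nhds
  · have hop : schrodingerOp X V ⟨ψ s, hmem s⟩ = η s := lp.ext (hHψ s).symm
    rw [hop]
    refine hasDerivAt_of_norm_sub_le_sq fun t => lp.norm_le_of_tendsto (l := (l : Filter ι))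
      (Eventually.of_forall fun i => hu' i s t) (tendsto_pi_nhds.2 fun n => ?_)
    exact ((hψ t n).sub (hψ s n)).sub (((hη s n).const_smul (-Complex.I)).const_smul (t - s))

theorem exists_isSchrodingerFlow_of_supportedIn (V : ℤ → ℝ) {M : ℕ} {φ : Ell2 X}
    (hφ : SupportedIn M (φ : X.sites → ℂ)) : ∃ ψ, IsSchrodingerFlow (schrodingerOp X V) φ ψ := by
  have hsymm (N : ℕ) := cutoffOp_isSymmetric X V (N + (M + 1))
  let B (N : ℕ) : Ell2 X →L[ℂ] Ell2 X := ⟨cutoffOp X V (N + (M + 1)), (hsymm N).continuous⟩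
  have hB (N : ℕ) : B N φ = cutoffOp X V (M + 1) φ :=
    cutoffOp_eq_of_supportedIn (hφ.mono (Nat.le_succ M)) (Nat.le_add_left _ _)
  have hBB (N : ℕ) : B N (B N φ) = cutoffOp X V (M + 1) (cutoffOp X V (M + 1) φ) := by
    rw [hB]
    exact cutoffOp_eq_of_supportedIn hφ.supportedIn_diffExpr (Nat.le_add_left _ _)
  refine exists_isSchrodingerFlow_of_tendsto (hyperfilter ℕ)
    ((tendsto_add_atTop_nat (M + 1)).mono_left Nat.hyperfilter_le_atTop)
    (K' := ‖cutoffOp X V (M + 1) φ‖) (u := fun N t => expFlow (B N) t φ)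
    (fun N => (isSchrodingerFlow_expFlow (B N) φ).1)
    (fun N t => (norm_expFlow_apply (hsymm N) t φ).le) (fun N t => ?_)
    (fun N s t => hBB N ▸ norm_expFlow_apply_sub_sub_smul_le (hsymm N) φ s t)
  calc ‖B N (expFlow (B N) t φ)‖ = ‖B N φ‖ := by
        rw [apply_expFlow_apply, norm_expFlow_apply (hsymm N)]
    _ ≤ ‖cutoffOp X V (M + 1) φ‖ := (congrArg norm (hB N)).le

theorem isSchrodingerFlow_schrodingerEvolution (V : ℤ → ℝ) (n : X.sites) :
    IsSchrodingerFlow (schrodingerOp X V) (delta X n)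
      (schrodingerEvolution (schrodingerOp X V) (delta X n)) :=
  Classical.epsilon_spec (exists_isSchrodingerFlow_of_supportedIn V (supportedIn_delta n))

end Existence

/-! ### The resolvent as a Laplace transform -/

section Resolvent

variable {E : Type*} [NormedAddCommGroup E] [InnerProductSpace ℂ E] {H : E →ₗ.[ℂ] E} {φ : E}
  {ψ : ℝ → E} {z : ℂ}

theorem injective_sub_smul_of_isFormalAdjoint (hH : H.IsFormalAdjoint H) (hz : z.im ≠ 0) :
    Function.Injective fun x : H.domain => H x - z • (x : E) := by
  intro x y hxy
  rw [← sub_eq_zero]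
  set w := x - y with hw
  have eigen : H w = z • (w : E) := by
    rw [hw, LinearPMap.map_sub, Submodule.coe_sub, smul_sub]
    exact sub_eq_sub_iff_sub_eq_sub.1 hxy
  have symm := hH w w
  rw [eigen, inner_smul_left, inner_smul_right] at symm
  by_contra hne
  have hinner : inner ℂ (w : E) (w : E) ≠ 0 :=
    inner_self_ne_zero.2 fun h => hne (Subtype.ext h)
  exact hz (Complex.conj_eq_iff_im.1 (mul_right_cancel₀ hinner symm))

theorem resolventMap_eq (hH : H.IsFormalAdjoint H) (hz : z.im ≠ 0) {x : H.domain}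
    (hx : H x - z • (x : E) = φ) : resolventMap H z φ = x :=
  injective_sub_smul_of_isFormalAdjoint hH hz <|
    (Function.invFun_eq (f := fun x : H.domain => H x - z • (x : E)) ⟨x, hx⟩).trans hx.symm

theorem IsSchrodingerFlow.hasDerivAt_exp_mul_inner (hH : H.IsFormalAdjoint H)
    (h : IsSchrodingerFlow H φ ψ) (z : ℂ) (χ : H.domain) (t : ℝ) :
    HasDerivAt (fun t : ℝ => Complex.exp (Complex.I * z * t) * inner ℂ (χ : E) (ψ t))
      (Complex.exp (Complex.I * z * t) •
        (Complex.I * (z * inner ℂ (χ : E) (ψ t) - inner ℂ (H χ) (ψ t)))) t := by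
  obtain ⟨ht, hdt⟩ := h.2 t
  have hinner :
      HasDerivAt (fun t => inner ℂ (χ : E) (ψ t)) (-Complex.I * inner ℂ (H χ) (ψ t)) t := by
    convert! (hasDerivAt_const t (χ : E)).inner ℂ hdt using 1
    rw [inner_smul_right, ← hH χ ⟨ψ t, ht⟩]
    simp
  have hexp : HasDerivAt (fun t : ℝ => Complex.exp (Complex.I * z * t))
      (Complex.exp (Complex.I * z * t) * (Complex.I * z)) t := by
    simpa using (Complex.ofRealCLM.hasDerivAt.const_mul (Complex.I * z)).cexp
  convert! hexp.mul hinner using 1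
  rw [smul_eq_mul]
  ring

theorem tendsto_exp_I_mul_mul_atTop {f : ℝ → ℂ} {K : ℝ} (hK : ∀ t, ‖f t‖ ≤ K) (hz : 0 < z.im) :
    Tendsto (fun t : ℝ => Complex.exp (Complex.I * z * t) * f t) atTop (𝓝 0) := by
  have hexp : Tendsto (fun t : ℝ => Real.exp (-z.im * t) * K) atTop (𝓝 0) := by
    simpa using (Real.tendsto_exp_neg_atTop_nhds_zero.comp
      (tendsto_id.const_mul_atTop hz)).mul_const K
  refine squeeze_zero_norm (fun t => ?_) hexp
  rw [norm_mul, norm_exp_I_mul_mul]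
  exact mul_le_mul_of_nonneg_left (hK t) (Real.exp_nonneg _)

theorem IsSchrodingerFlow.inner_laplace [CompleteSpace E] (hH : H.IsFormalAdjoint H)
    (h : IsSchrodingerFlow H φ ψ) (hz : 0 < z.im) (χ : H.domain) :
    inner ℂ (H χ) (Complex.I • laplace ψ z)
      = z * inner ℂ (χ : E) (Complex.I • laplace ψ z) + inner ℂ (χ : E) φ := by
  have hψ (t : ℝ) : ‖ψ t‖ ≤ ‖φ‖ := (h.norm_eq hH t).le
  have hbound (x : E) (t : ℝ) : ‖inner ℂ x (ψ t)‖ ≤ ‖x‖ * ‖φ‖ :=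
    (norm_inner_le_norm _ _).trans (mul_le_mul_of_nonneg_left (hψ t) (norm_nonneg _))
  let D : E →L[ℂ] ℂ := Complex.I • (z • innerSL ℂ (χ : E) - innerSL ℂ (H χ))
  have ftc : D (laplace ψ z) = -inner ℂ (χ : E) φ := by
    rw [← laplace_clm_comp D h.continuous hψ hz]
    have := integral_Ioi_of_hasDerivAt_of_tendsto' (a := 0)
      (fun t _ => h.hasDerivAt_exp_mul_inner hH z χ t)
      (integrableOn_exp_smul (D.continuous.comp h.continuous)
        (fun t => (D.le_opNorm _).trans (mul_le_mul_of_nonneg_left (hψ t) (norm_nonneg _))) hz)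
      (tendsto_exp_I_mul_mul_atTop (hbound χ) hz)
    simpa [h.1, laplace, D] using this
  simp only [D, smul_apply, sub_apply,
    innerSL_apply_apply, smul_eq_mul] at ftc
  rw [inner_smul_right, inner_smul_right]
  linear_combination -ftc

end Resolvent

/-! ### The Green function -/

section GreenFunction

variable {X : Lattice} {V : ℤ → ℝ}

/-- The Green function `n ↦ ⟨(H - z)⁻¹ δ₁, δ_n⟩`, as an element of `ℓ²`. -/
def greenState (X : Lattice) (V : ℤ → ℝ) (z : ℂ) : Ell2 X :=
  (resolventMap (schrodingerOp X V) z (delta X X.one) : Ell2 X)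

theorem borelTransform_eq_greenState (z : ℂ) : borelTransform X V z = greenState X V z X.one :=
  inner_delta _ _

theorem norm_schrodingerEvolution (V : ℤ → ℝ) (n : X.sites) (t : ℝ) :
    ‖schrodingerEvolution (schrodingerOp X V) (delta X n) t‖ = ‖delta X n‖ :=
  (isSchrodingerFlow_schrodingerEvolution V n).norm_eq (schrodingerOp_isFormalAdjoint_self X V) t

theorem norm_schrodingerEvolution_apply_le (V : ℤ → ℝ) (n m : X.sites) (t : ℝ) :
    ‖schrodingerEvolution (schrodingerOp X V) (delta X n) t m‖ ≤ ‖delta X n‖ :=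
  (lp.norm_apply_le_norm two_ne_zero _ _).trans (norm_schrodingerEvolution V n t).le

theorem continuous_schrodingerEvolution_apply (V : ℤ → ℝ) (n m : X.sites) :
    Continuous fun t => schrodingerEvolution (schrodingerOp X V) (delta X n) t m :=
  (lp.evalCLM ℂ (fun _ : X.sites => ℂ) 2 m).continuous.comp
    (isSchrodingerFlow_schrodingerEvolution V n).continuous

theorem diffExpr_laplace_schrodingerEvolution {z : ℂ} (hz : 0 < z.im) (m : X.sites) :
    diffExpr X V ((Complex.I • laplace (schrodingerEvolution (schrodingerOp X V) (delta X m)) z :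
        Ell2 X) : X.sites → ℂ)
      = ((z • Complex.I • laplace (schrodingerEvolution (schrodingerOp X V) (delta X m)) z
        + delta X m : Ell2 X) : X.sites → ℂ) := by
  funext n
  rw [← inner_schrodingerOp_delta, (isSchrodingerFlow_schrodingerEvolution V m).inner_laplace
    (schrodingerOp_isFormalAdjoint_self X V) hz, inner_delta, inner_delta]
  rfl

theorem greenState_eq_laplace {z : ℂ} (hz : 0 < z.im) :
    greenState X V z = Complex.I •
      laplace (schrodingerEvolution (schrodingerOp X V) (delta X X.one)) z := by
  set G : Ell2 X := Complex.I •
    laplace (schrodingerEvolution (schrodingerOp X V) (delta X X.one)) z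
  have hdiff : diffExpr X V (G : X.sites → ℂ) = ((z • G + delta X X.one : Ell2 X) : X.sites → ℂ) :=
    diffExpr_laplace_schrodingerEvolution hz X.one
  have hmem : G ∈ (schrodingerOp X V).domain := by
    change Memℓp (diffExpr X V (G : X.sites → ℂ)) 2
    exact hdiff ▸ lp.memℓp _
  have hres : schrodingerOp X V ⟨G, hmem⟩ - z • G = delta X X.one :=
    sub_eq_iff_eq_add'.2 (lp.ext hdiff)
  rw [greenState, resolventMap_eq (schrodingerOp_isFormalAdjoint_self X V) hz.ne' hres]

theorem greenState_apply_eq_laplace {z : ℂ} (hz : 0 < z.im) (n : X.sites) :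
    greenState X V z n = Complex.I *
      laplace (fun t => schrodingerEvolution (schrodingerOp X V) (delta X X.one) t n) z := by
  rw [greenState_eq_laplace hz]
  exact congrArg (Complex.I * ·) (laplace_clm_comp (lp.evalCLM ℂ (fun _ : X.sites => ℂ) 2 n)
    (isSchrodingerFlow_schrodingerEvolution V X.one).continuous
    (fun t => (norm_schrodingerEvolution V X.one t).le) hz).symm

theorem diffExpr_greenState {z : ℂ} (hz : 0 < z.im) (n : X.sites) :
    diffExpr X V (greenState X V z) n = z * greenState X V z n + delta X X.one n := by
  rw [greenState_eq_laplace hz, diffExpr_laplace_schrodingerEvolution hz]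
  rfl

theorem continuous_greenState_apply {ε : ℝ} (hε : 0 < ε) (n : X.sites) :
    Continuous fun E : ℝ => greenState X V (E + Complex.I * ε) n := by
  have hz (E : ℝ) : 0 < ((E : ℂ) + Complex.I * ε).im := by simpa using hε
  simp_rw [fun E : ℝ => greenState_apply_eq_laplace (V := V) (hz E) n]
  exact continuous_const.mul (continuous_laplace (continuous_schrodingerEvolution_apply V _ n)
    (norm_schrodingerEvolution_apply_le V _ n) hε)

theorem timeAvgProb_eq_lintegral_greenState (V : ℤ → ℝ) (n : X.sites) {T : ℝ} (hT : 0 < T) :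
    timeAvgProb X V n T = ENNReal.ofReal (1 / T / Real.pi) *
      ∫⁻ E : ℝ, ‖greenState X V (E + Complex.I * (1 / T : ℝ)) n‖ₑ ^ 2 := by
  have hε : 0 < 1 / T := by positivity
  have hz (E : ℝ) : 0 < ((E : ℂ) + Complex.I * (1 / T : ℝ)).im := by simpa using hε
  simp_rw [fun E : ℝ => greenState_apply_eq_laplace (V := V) (hz E) n, enorm_mul,
    show ‖Complex.I‖ₑ = 1 by simp [← ofReal_norm], one_mul]
  rw [lintegral_enorm_laplace_sq (continuous_schrodingerEvolution_apply V _ n)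
    (norm_schrodingerEvolution_apply_le V _ n) hε, ← mul_assoc,
    ← ENNReal.ofReal_mul (by positivity), timeAvgProb]
  congr 2
  · field_simp
  · funext t
    rw [inner_delta]
    congr 3
    ring

theorem avgMoment_eq_lintegral_greenState (V : ℤ → ℝ) (p : ℝ) {T : ℝ} (hT : 0 < T) :
    avgMoment X V p T = ENNReal.ofReal (1 / T / Real.pi) *
      ∫⁻ E : ℝ, ∑' n : X.sites, ENNReal.ofReal (|((n : ℤ) : ℝ)| ^ p) *
        ‖greenState X V (E + Complex.I * (1 / T : ℝ)) n‖ₑ ^ 2 := by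
  have hmeas (n : X.sites) :
      Measurable fun E : ℝ => ‖greenState X V (E + Complex.I * (1 / T : ℝ)) n‖ₑ ^ 2 :=
    (continuous_greenState_apply (by positivity) n).enorm.measurable.pow_const 2
  rw [lintegral_tsum fun n => ((hmeas n).const_mul _).aemeasurable, avgMoment,
    ← ENNReal.tsum_mul_left]
  refine tsum_congr fun n => ?_
  rw [timeAvgProb_eq_lintegral_greenState V n hT, lintegral_const_mul _ (hmeas n)]
  ring

end GreenFunction

/-! ### Truncated sums -/

section TruncSum

/-- The weight of the site `n ≥ 1` in a sum truncated at the real number `L`: it is `1` for `n ≤ L`,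
`L - ⌊L⌋` for `n = ⌊L⌋ + 1` and `0` beyond. -/
def siteWeight (L : ℝ) (n : ℕ) : ℝ := max 0 (min 1 (L - (n - 1)))

/-- The sum `∑_{1 ≤ n ≤ L} f(n) + (L - ⌊L⌋) f(⌊L⌋ + 1)` that underlies `normSqUpTo`, for an
arbitrary summand and in a form that is visibly continuous in `L`. -/
def truncSum (L : ℝ) (f : ℕ → ℝ) : ℝ := ∑ n ∈ Finset.Icc 1 ⌈L⌉₊, siteWeight L n * f n

theorem siteWeight_nonneg (L : ℝ) (n : ℕ) : 0 ≤ siteWeight L n := le_max_left _ _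

theorem siteWeight_le_one (L : ℝ) (n : ℕ) : siteWeight L n ≤ 1 :=
  max_le zero_le_one (min_le_left _ _)

theorem siteWeight_mono (n : ℕ) : Monotone fun L => siteWeight L n := fun L L' h => by
  simp only [siteWeight]; gcongr

theorem siteWeight_eq_one {L : ℝ} {n : ℕ} (h : n ≤ L) : siteWeight L n = 1 := by
  rw [siteWeight, min_eq_left (by linarith), max_eq_right zero_le_one]

theorem siteWeight_eq_zero {L : ℝ} {n : ℕ} (h : L ≤ n - 1) : siteWeight L n = 0 :=
  max_eq_left ((min_le_right _ _).trans (by linarith))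

variable {L l : ℝ} {f g : ℕ → ℝ}

theorem truncSum_eq_sum {N : ℕ} (h : L ≤ N) (f : ℕ → ℝ) :
    truncSum L f = ∑ n ∈ Finset.Icc 1 N, siteWeight L n * f n := by
  refine Finset.sum_subset (Finset.Icc_subset_Icc_right (Nat.ceil_le.2 h)) fun n hn hn' => ?_
  have hlt : ⌈L⌉₊ + 1 ≤ n := by simp only [Finset.mem_Icc] at hn hn'; omega
  have : (⌈L⌉₊ : ℝ) + 1 ≤ n := by exact_mod_cast hlt
  rw [siteWeight_eq_zero (by linarith [Nat.le_ceil L]), zero_mul]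

theorem truncSum_nonneg (L : ℝ) (hf : ∀ n, 0 ≤ f n) : 0 ≤ truncSum L f :=
  Finset.sum_nonneg fun n _ => mul_nonneg (siteWeight_nonneg L n) (hf n)

theorem truncSum_le_truncSum (h : ∀ n : ℕ, n - 1 < L → f n ≤ g n) :
    truncSum L f ≤ truncSum L g := by
  refine Finset.sum_le_sum fun n _ => ?_
  rcases le_or_gt L (n - 1) with hn | hn
  · simp only [siteWeight_eq_zero hn, zero_mul, le_refl]
  · exact mul_le_mul_of_nonneg_left (h n hn) (siteWeight_nonneg L n)

theorem truncSum_add (L : ℝ) (f g : ℕ → ℝ) :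
    truncSum L (fun n => f n + g n) = truncSum L f + truncSum L g := by
  simp only [truncSum, mul_add, Finset.sum_add_distrib]

theorem truncSum_const_mul (L a : ℝ) (f : ℕ → ℝ) :
    truncSum L (fun n => a * f n) = a * truncSum L f := by
  simp only [truncSum, Finset.mul_sum, mul_left_comm]

theorem truncSum_sub_truncSum (h : l ≤ L) (f : ℕ → ℝ) :
    truncSum L f - truncSum l f
      = ∑ n ∈ Finset.Icc 1 ⌈L⌉₊, (siteWeight L n - siteWeight l n) * f n := by
  rw [truncSum_eq_sum (h.trans (Nat.le_ceil L)), truncSum]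
  simp only [sub_mul, Finset.sum_sub_distrib]

theorem truncSum_sub_truncSum_le (h : l ≤ L) (hfg : ∀ n, f n ≤ g n) :
    truncSum L f - truncSum l f ≤ truncSum L g - truncSum l g := by
  simp only [truncSum_sub_truncSum h]
  exact Finset.sum_le_sum fun n _ =>
    mul_le_mul_of_nonneg_left (hfg n) (sub_nonneg.2 (siteWeight_mono n h))

theorem truncSum_mono_left (hf : ∀ n, 0 ≤ f n) (h : l ≤ L) : truncSum l f ≤ truncSum L f := by
  have := truncSum_sub_truncSum_le h hf
  simp only [truncSum, mul_zero, Finset.sum_const_zero, sub_zero] at this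
  exact sub_nonneg.1 this

theorem continuous_truncSum (f : ℕ → ℝ) : Continuous fun L => truncSum L f := by
  refine continuous_iff_continuousAt.2 fun L => ?_
  have hsum : Continuous fun L' => ∑ n ∈ Finset.Icc 1 (⌈L⌉₊ + 1), siteWeight L' n * f n := by
    unfold siteWeight; fun_prop
  refine hsum.continuousAt.congr ?_
  have hlt : L < (⌈L⌉₊ + 1 : ℕ) := by push_cast; linarith [Nat.le_ceil L]
  filter_upwards [Iio_mem_nhds hlt] with L' hL' using (truncSum_eq_sum hL'.le f).symm

theorem sum_Ico_le_truncSum {n : ℕ} (hf : ∀ n, 0 ≤ f n) (hn : n - 1 < L) :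
    ∑ j ∈ Finset.Ico 1 n, f j ≤ truncSum L f := by
  have hle {j : ℕ} (hj : j < n) : (j : ℝ) ≤ L := by
    have : (j : ℝ) + 1 ≤ n := by exact_mod_cast hj
    linarith
  calc ∑ j ∈ Finset.Ico 1 n, f j
      = ∑ j ∈ Finset.Ico 1 n, siteWeight L j * f j := Finset.sum_congr rfl fun j hj => by
        rw [siteWeight_eq_one (hle (Finset.mem_Ico.1 hj).2), one_mul]
    _ ≤ truncSum L f := by
      refine Finset.sum_le_sum_of_subset_of_nonneg (fun j hj => ?_)
        fun j _ _ => mul_nonneg (siteWeight_nonneg L j) (hf j)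
      obtain ⟨h1, h2⟩ := Finset.mem_Ico.1 hj
      exact Finset.mem_Icc.2 ⟨h1, Nat.cast_le.1 ((hle h2).trans (Nat.le_ceil L))⟩

theorem rpow_mul_truncSum_sub_le {p : ℝ} (hp : 0 ≤ p) (hl : 0 ≤ l) (h : l ≤ L)
    (hf : ∀ n, 0 ≤ f n) :
    l ^ p * (truncSum L f - truncSum l f) ≤ ∑ n ∈ Finset.Icc 1 ⌈L⌉₊, (n : ℝ) ^ p * f n := by
  rw [truncSum_sub_truncSum h, Finset.mul_sum]
  refine Finset.sum_le_sum fun n _ => ?_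
  rcases le_or_gt (n : ℝ) l with hn | hn
  · rw [siteWeight_eq_one hn, siteWeight_eq_one (hn.trans h), sub_self, zero_mul, mul_zero]
    exact mul_nonneg (by positivity) (hf n)
  · have weight_le : siteWeight L n - siteWeight l n ≤ 1 :=
      (sub_le_self _ (siteWeight_nonneg l n)).trans (siteWeight_le_one L n)
    exact mul_le_mul (Real.rpow_le_rpow hl hn.le hp) (mul_le_of_le_one_left (hf n) weight_le)
      (mul_nonneg (sub_nonneg.2 (siteWeight_mono n h)) (hf n)) (by positivity)

theorem normSqUpTo_eq_truncSum (u : ℕ → ℝ) (hL : 0 ≤ L) :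
    normSqUpTo u L = truncSum L fun n => u n ^ 2 := by
  have hle : (⌊L⌋₊ : ℝ) ≤ L := Nat.floor_le hL
  have hlt : L < ⌊L⌋₊ + 1 := Nat.lt_floor_add_one L
  rw [truncSum_eq_sum (N := ⌊L⌋₊ + 1) (by push_cast; exact hlt.le),
    Finset.sum_Icc_succ_top (by omega), normSqUpTo]
  congr 1
  · refine Finset.sum_congr rfl fun n hn => ?_
    have : (n : ℝ) ≤ ⌊L⌋₊ := by exact_mod_cast (Finset.mem_Icc.1 hn).2
    rw [siteWeight_eq_one (this.trans hle), one_mul]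
  · rw [siteWeight, min_eq_right (by push_cast; linarith), max_eq_right (by push_cast; linarith)]
    push_cast
    ring

theorem normSqUpTo_mono (u : ℕ → ℝ) (hl : 0 ≤ l) (h : l ≤ L) :
    normSqUpTo u l ≤ normSqUpTo u L := by
  rw [normSqUpTo_eq_truncSum u hl, normSqUpTo_eq_truncSum u (hl.trans h)]
  exact truncSum_mono_left (fun n => sq_nonneg _) h

theorem normSqUpTo_nonneg (u : ℕ → ℝ) (hL : 0 ≤ L) : 0 ≤ normSqUpTo u L := by
  rw [normSqUpTo_eq_truncSum u hL]
  exact truncSum_nonneg L fun n => sq_nonneg _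

theorem normSqUpTo_smul (u : ℕ → ℝ) (c L : ℝ) :
    normSqUpTo (fun n => c * u n) L = c ^ 2 * normSqUpTo u L := by
  simp only [normSqUpTo, mul_pow, ← Finset.mul_sum]
  ring

end TruncSum

/-! ### Gram determinants -/

section GramDet

variable (L : ℝ) (u v : ℕ → ℝ)

/-- The Gram determinant of `u` and `v` for the inner product `truncSum L (u * v)`. -/
def gramDet : ℝ :=
  truncSum L (fun n => u n ^ 2) * truncSum L (fun n => v n ^ 2)
    - truncSum L (fun n => u n * v n) ^ 2

theorem continuous_gramDet : Continuous fun L => gramDet L u v :=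
  ((continuous_truncSum _).mul (continuous_truncSum _)).sub ((continuous_truncSum _).pow 2)

theorem gramDet_le_mul :
    gramDet L u v ≤ truncSum L (fun n => u n ^ 2) * truncSum L (fun n => v n ^ 2) :=
  sub_le_self _ (sq_nonneg _)

theorem truncSum_linearComb_mul (x y s t : ℝ) :
    truncSum L (fun n => (x * u n + y * v n) * (s * u n + t * v n))
      = x * s * truncSum L (fun n => u n ^ 2) + (x * t + y * s) * truncSum L (fun n => u n * v n)
        + y * t * truncSum L (fun n => v n ^ 2) := by
  simp only [← truncSum_const_mul, ← truncSum_add]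
  exact congrArg (truncSum L) (funext fun n => by ring)

theorem truncSum_linearComb_sq (x y : ℝ) :
    truncSum L (fun n => (x * u n + y * v n) ^ 2)
      = x ^ 2 * truncSum L (fun n => u n ^ 2) + 2 * x * y * truncSum L (fun n => u n * v n)
        + y ^ 2 * truncSum L (fun n => v n ^ 2) := by
  simp only [pow_two (_ + _), truncSum_linearComb_mul]
  ring

theorem gramDet_linearComb (x y s t : ℝ) :
    gramDet L (fun n => x * u n + y * v n) (fun n => s * u n + t * v n)
      = (x * t - y * s) ^ 2 * gramDet L u v := by
  simp only [gramDet, truncSum_linearComb_sq, truncSum_linearComb_mul]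
  ring

variable {L u v} in
theorem sq_le_gramDet {m : ℝ} (hm : 0 ≤ m)
    (h : ∀ x y, m * (x ^ 2 + y ^ 2) ≤ truncSum L fun n => (x * u n + y * v n) ^ 2) :
    m ^ 2 ≤ gramDet L u v := by
  simp only [truncSum_linearComb_sq] at h
  rw [gramDet]
  set a := truncSum L fun n => u n ^ 2
  set b := truncSum L fun n => v n ^ 2
  set c := truncSum L fun n => u n * v n
  have ha : m ≤ a := by linarith [h 1 0]
  have hb : m ≤ b := by linarith [h 0 1]
  have hdiscrim : discrim (a - m) (2 * c) (b - m) ≤ 0 :=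
    discrim_le_zero fun x => by linarith [h x 1]
  rw [discrim] at hdiscrim
  linarith [mul_nonneg hm (sub_nonneg.2 ha), mul_nonneg hm (sub_nonneg.2 hb)]

theorem truncSum_truncSum_wronskian_sq :
    truncSum L (fun n => truncSum L fun j => (u j * v n - v j * u n) ^ 2)
      = 2 * gramDet L u v := by
  have inner_sum (n : ℕ) : truncSum L (fun j => (u j * v n - v j * u n) ^ 2)
      = truncSum L (fun j => u j ^ 2) * v n ^ 2
        + (-2 * truncSum L (fun j => u j * v j) * (u n * v n)
          + truncSum L (fun j => v j ^ 2) * u n ^ 2) := by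
    have := truncSum_linearComb_sq L u v (v n) (-u n)
    simp only [show ∀ j, u j * v n - v j * u n = v n * u j + -u n * v j from fun j => by ring, this]
    ring
  simp only [inner_sum, truncSum_add, truncSum_const_mul, gramDet]
  ring

end GramDet

/-! ### Solutions of the difference equation -/

section Solutions

variable {V : ℤ → ℝ} {E : ℝ}

/-- The solution at energy `E` with `u(0) = x` and `u(1) = y`. -/
def solutionOf (V : ℤ → ℝ) (E x y : ℝ) : ℕ → ℝ
  | 0 => x
  | 1 => y
  | n + 2 => (E - V ((n : ℤ) + 1)) * solutionOf V E x y (n + 1) - solutionOf V E x y n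

theorem solutionOf_zero (V : ℤ → ℝ) (E x y : ℝ) : solutionOf V E x y 0 = x := by rw [solutionOf]

theorem solutionOf_one (V : ℤ → ℝ) (E x y : ℝ) : solutionOf V E x y 1 = y := by rw [solutionOf]

theorem solutionOf_add_two (V : ℤ → ℝ) (E x y : ℝ) (n : ℕ) : solutionOf V E x y (n + 2)
    = (E - V ((n : ℤ) + 1)) * solutionOf V E x y (n + 1) - solutionOf V E x y n := by
  rw [solutionOf]

theorem isSolution_solutionOf (V : ℤ → ℝ) (E x y : ℝ) : IsSolution V E (solutionOf V E x y) := by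
  intro n hn
  obtain ⟨m, rfl⟩ := Nat.exists_eq_add_of_le' hn
  rw [Nat.add_sub_cancel, solutionOf_add_two]
  push_cast
  ring

theorem isNormalized_solutionOf (V : ℤ → ℝ) (E : ℝ) {x y : ℝ} (h : x ^ 2 + y ^ 2 = 1) :
    IsNormalized (solutionOf V E x y) := by
  rwa [IsNormalized, solutionOf_zero, solutionOf_one]

theorem IsSolution.eq_solutionOf {u : ℕ → ℝ} (hu : IsSolution V E u) :
    u = solutionOf V E (u 0) (u 1) := by
  funext n
  induction n using Nat.twoStepInduction with
  | zero => rw [solutionOf_zero]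
  | one => rw [solutionOf_one]
  | more n h1 h2 =>
    rw [solutionOf_add_two, ← h1, ← h2]
    have := hu (n + 1) n.succ_pos
    rw [Nat.add_sub_cancel] at this
    push_cast at this
    linear_combination this

theorem IsSolution.const_mul {u : ℕ → ℝ} (h : IsSolution V E u) (c : ℝ) :
    IsSolution V E fun n => c * u n := fun n hn => by
  linear_combination c * h n hn

theorem solutionOf_eq_linearComb (V : ℤ → ℝ) (E x y : ℝ) :
    solutionOf V E x y = fun n => x * solutionOf V E 1 0 n + y * solutionOf V E 0 1 n := by
  funext n
  induction n using Nat.twoStepInduction with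
  | zero => simp only [solutionOf_zero]; ring
  | one => simp only [solutionOf_one]; ring
  | more n h1 h2 => simp only [solutionOf_add_two, h1, h2]; ring

theorem mul_sq_add_sq_le_normSqUpTo {B L : ℝ} (hL : 0 ≤ L)
    (hB : ∀ u, IsSolution V E u → IsNormalized u → B ≤ normSqUpTo u L)
    {u : ℕ → ℝ} (hu : IsSolution V E u) : B * (u 0 ^ 2 + u 1 ^ 2) ≤ normSqUpTo u L := by
  set s := u 0 ^ 2 + u 1 ^ 2 with hs
  rcases (by positivity : 0 ≤ s).eq_or_lt with h0 | h0
  · rw [← h0, mul_zero]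
    exact normSqUpTo_nonneg u hL
  · have hsq : (√s)⁻¹ ^ 2 = s⁻¹ := by rw [inv_pow, Real.sq_sqrt h0.le]
    have hnorm : IsNormalized fun n => (√s)⁻¹ * u n := by
      rw [IsNormalized, mul_pow, mul_pow, ← mul_add, ← hs, hsq, inv_mul_cancel₀ h0.ne']
    have := hB _ (hu.const_mul _) hnorm
    rw [normSqUpTo_smul, hsq] at this
    rwa [← le_div_iff₀ h0, div_eq_inv_mul]

/-- The Gram determinant of the two standard solutions at energy `E`, i.e. the determinant of the
quadratic form `(u(0), u(1)) ↦ ‖u‖_L²` on the space of solutions. -/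
def solutionGramDet (V : ℤ → ℝ) (E L : ℝ) : ℝ :=
  gramDet L (solutionOf V E 1 0) (solutionOf V E 0 1)

theorem solutionGramDet_eq_gramDet {x y : ℝ} (h : x ^ 2 + y ^ 2 = 1) (L : ℝ) :
    solutionGramDet V E L = gramDet L (solutionOf V E x y) (solutionOf V E (-y) x) := by
  rw [solutionOf_eq_linearComb V E x y, solutionOf_eq_linearComb V E (-y) x, gramDet_linearComb,
    show x * x - y * -y = 1 by linear_combination h, one_pow, one_mul, solutionGramDet]

theorem solutionGramDet_le_normSqUpTo_mul {x y : ℝ} (h : x ^ 2 + y ^ 2 = 1) {L : ℝ} (hL : 0 ≤ L) :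
    solutionGramDet V E L
      ≤ normSqUpTo (solutionOf V E x y) L * normSqUpTo (solutionOf V E (-y) x) L := by
  rw [solutionGramDet_eq_gramDet h, normSqUpTo_eq_truncSum _ hL, normSqUpTo_eq_truncSum _ hL]
  exact gramDet_le_mul _ _ _

theorem sq_le_solutionGramDet {B L : ℝ} (hL : 0 ≤ L) (hB0 : 0 ≤ B)
    (hB : ∀ u, IsSolution V E u → IsNormalized u → B ≤ normSqUpTo u L) :
    B ^ 2 ≤ solutionGramDet V E L := by
  refine sq_le_gramDet hB0 fun x y => ?_
  have := mul_sq_add_sq_le_normSqUpTo hL hB (isSolution_solutionOf V E x y)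
  rwa [normSqUpTo_eq_truncSum _ hL, solutionOf_zero, solutionOf_one,
    solutionOf_eq_linearComb V E x y] at this

theorem solutionGramDet_two (V : ℤ → ℝ) (E : ℝ) : solutionGramDet V E 2 = 1 := by
  have hsum (f : ℕ → ℝ) : truncSum 2 f = f 1 + f 2 := by
    rw [truncSum_eq_sum (L := 2) (N := 2) (by norm_num)]
    norm_num [Finset.sum_Icc_succ_top, siteWeight]
  simp only [solutionGramDet, gramDet, hsum, solutionOf]
  ring

end Solutions

/-! ### Perturbation of the energy -/

section Perturbation

variable {V : ℤ → ℝ} {E : ℝ} {z : ℂ} {c : ℕ → ℂ}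

/-- `c`, given on the sites `0, 1, 2, …`, solves the difference equation at the complex energy `z`
on all sites `n ≥ 1`; the equation at `n + 1` is solved for its leading term. -/
def IsComplexSolution (V : ℤ → ℝ) (z : ℂ) (c : ℕ → ℂ) : Prop :=
  ∀ n : ℕ, c (n + 2) = (z - V ((n : ℤ) + 1)) * c (n + 1) - c n

/-- The complex solution at the real energy `E` with the values `a` and `b` at the sites `0` and
`1`. -/
def complexSolutionOf (V : ℤ → ℝ) (E : ℝ) (a b : ℂ) (n : ℕ) : ℂ :=
  a * solutionOf V E 1 0 n + b * solutionOf V E 0 1 n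

/-- The value at `n` of the solution at energy `E` that vanishes at `j` and equals `1` at `j + 1`:
the kernel of variation of parameters. -/
def propagator (V : ℤ → ℝ) (E : ℝ) (j n : ℕ) : ℝ :=
  solutionOf V E 1 0 j * solutionOf V E 0 1 n - solutionOf V E 0 1 j * solutionOf V E 1 0 n

theorem propagator_self (V : ℤ → ℝ) (E : ℝ) (n : ℕ) : propagator V E n n = 0 := by
  rw [propagator]
  ring

theorem propagator_add_two (V : ℤ → ℝ) (E : ℝ) (j n : ℕ) : propagator V E j (n + 2)
    = (E - V ((n : ℤ) + 1)) * propagator V E j (n + 1) - propagator V E j n := by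
  simp only [propagator, solutionOf_add_two V E _ _ n]
  ring

theorem propagator_succ (V : ℤ → ℝ) (E : ℝ) (n : ℕ) : propagator V E n (n + 1) = 1 := by
  induction n with
  | zero => simp only [propagator, solutionOf_zero, zero_add, solutionOf_one]; ring
  | succ n ih =>
    simp only [propagator, solutionOf_add_two] at ih ⊢
    linear_combination ih

theorem sum_propagator_add_two (V : ℤ → ℝ) (E : ℝ) (c : ℕ → ℂ) (n : ℕ) :
    ∑ j ∈ Finset.Ico 1 (n + 2), (propagator V E j (n + 2) : ℂ) * c j
      = (E - V ((n : ℤ) + 1)) * ∑ j ∈ Finset.Ico 1 (n + 1), (propagator V E j (n + 1) : ℂ) * c j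
        - ∑ j ∈ Finset.Ico 1 n, (propagator V E j n : ℂ) * c j + c (n + 1) := by
  have diagonal : ∑ j ∈ Finset.Ico 1 n, (propagator V E j n : ℂ) * c j
      = ∑ j ∈ Finset.Ico 1 (n + 1), (propagator V E j n : ℂ) * c j := by
    rcases n.eq_zero_or_pos with rfl | hn
    · simp
    · rw [Finset.sum_Ico_succ_top hn, propagator_self, Complex.ofReal_zero, zero_mul, add_zero]
  rw [diagonal, Finset.sum_Ico_succ_top (by omega), propagator_succ, Finset.mul_sum,
    ← Finset.sum_sub_distrib, Complex.ofReal_one, one_mul]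
  refine congrArg (· + c (n + 1)) (Finset.sum_congr rfl fun j _ => ?_)
  rw [propagator_add_two]
  push_cast
  ring

theorem IsComplexSolution.sub_complexSolutionOf_eq (hc : IsComplexSolution V z c) (E : ℝ) (n : ℕ) :
    c n - complexSolutionOf V E (c 0) (c 1) n
      = (z - E) * ∑ j ∈ Finset.Ico 1 n, (propagator V E j n : ℂ) * c j := by
  induction n using Nat.twoStepInduction with
  | zero => simp [complexSolutionOf, solutionOf]
  | one => simp [complexSolutionOf, solutionOf]
  | more n h1 h2 =>
    rw [sum_propagator_add_two, hc n]
    simp only [complexSolutionOf, solutionOf_add_two] at h1 h2 ⊢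
    push_cast
    linear_combination (E - V ((n : ℤ) + 1) : ℂ) * h2 - h1

theorem IsComplexSolution.truncSum_norm_sub_sq_le (hc : IsComplexSolution V z c) (E L : ℝ) :
    truncSum L (fun n => ‖c n - complexSolutionOf V E (c 0) (c 1) n‖ ^ 2)
      ≤ ‖z - E‖ ^ 2 * (2 * solutionGramDet V E L) * truncSum L fun n => ‖c n‖ ^ 2 := by
  set G := truncSum L fun n => ‖c n‖ ^ 2
  have pointwise (n : ℕ) (hn : n - 1 < L) :
      ‖c n - complexSolutionOf V E (c 0) (c 1) n‖ ^ 2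
        ≤ ‖z - E‖ ^ 2 * G * truncSum L fun j => propagator V E j n ^ 2 := by
    rw [hc.sub_complexSolutionOf_eq E n, norm_mul, mul_pow, mul_assoc]
    gcongr
    calc ‖∑ j ∈ Finset.Ico 1 n, (propagator V E j n : ℂ) * c j‖ ^ 2
        ≤ (∑ j ∈ Finset.Ico 1 n, ‖c j‖ * |propagator V E j n|) ^ 2 := by
          gcongr
          refine (norm_sum_le _ _).trans_eq (Finset.sum_congr rfl fun j _ => ?_)
          rw [norm_mul, Complex.norm_real, Real.norm_eq_abs, mul_comm]
      _ ≤ (∑ j ∈ Finset.Ico 1 n, ‖c j‖ ^ 2) * ∑ j ∈ Finset.Ico 1 n, |propagator V E j n| ^ 2 :=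
          Finset.sum_mul_sq_le_sq_mul_sq _ _ _
      _ ≤ G * truncSum L fun j => propagator V E j n ^ 2 := by
          simp only [sq_abs]
          exact mul_le_mul (sum_Ico_le_truncSum (fun _ => sq_nonneg _) hn)
            (sum_Ico_le_truncSum (fun _ => sq_nonneg _) hn)
            (Finset.sum_nonneg fun _ _ => sq_nonneg _) (truncSum_nonneg L fun _ => sq_nonneg _)
  refine (truncSum_le_truncSum pointwise).trans_eq ?_
  simp only [truncSum_const_mul, propagator, truncSum_truncSum_wronskian_sq, solutionGramDet]
  ring

theorem norm_complexSolutionOf_sq (V : ℤ → ℝ) (E : ℝ) (a b : ℂ) (n : ℕ) :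
    ‖complexSolutionOf V E a b n‖ ^ 2
      = solutionOf V E a.re b.re n ^ 2 + solutionOf V E a.im b.im n ^ 2 := by
  rw [solutionOf_eq_linearComb V E a.re, solutionOf_eq_linearComb V E a.im,
    ← Complex.normSq_eq_norm_sq, Complex.normSq_apply, complexSolutionOf]
  simp
  ring

theorem truncSum_norm_complexSolutionOf_sq (V : ℤ → ℝ) (E : ℝ) (a b : ℂ) {L : ℝ} (hL : 0 ≤ L) :
    truncSum L (fun n => ‖complexSolutionOf V E a b n‖ ^ 2)
      = normSqUpTo (solutionOf V E a.re b.re) L + normSqUpTo (solutionOf V E a.im b.im) L := by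
  simp only [norm_complexSolutionOf_sq, truncSum_add, normSqUpTo_eq_truncSum _ hL]

theorem mul_norm_sq_le_truncSum_complexSolutionOf {B L : ℝ} (hL : 0 ≤ L)
    (hB : ∀ u, IsSolution V E u → IsNormalized u → B ≤ normSqUpTo u L) (a b : ℂ) :
    B * (‖a‖ ^ 2 + ‖b‖ ^ 2) ≤ truncSum L fun n => ‖complexSolutionOf V E a b n‖ ^ 2 := by
  have hre := mul_sq_add_sq_le_normSqUpTo hL hB (isSolution_solutionOf V E a.re b.re)
  have him := mul_sq_add_sq_le_normSqUpTo hL hB (isSolution_solutionOf V E a.im b.im)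
  rw [solutionOf_zero, solutionOf_one] at hre him
  rw [truncSum_norm_complexSolutionOf_sq V E a b hL]
  simp only [← Complex.normSq_eq_norm_sq, Complex.normSq_apply]
  linarith

end Perturbation

/-! ### Power-law growth of solutions -/

section Growth

variable {V : ℤ → ℝ} {A : Set ℝ} {C α D κ L₁ E L : ℝ} {u : ℕ → ℝ}

theorem UpperPowerBound.one_le (ha : UpperPowerBound V A C α) (hA : A.Nonempty) : 1 ≤ C := by
  obtain ⟨E, hE⟩ := hA
  simpa [normSqUpTo, solutionOf] using ha E hE _ (isSolution_solutionOf V E 0 1)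
    (isNormalized_solutionOf V E (by norm_num)) 1 le_rfl

theorem UpperPowerBound.solutionGramDet_div_le_normSqUpTo (ha : UpperPowerBound V A C α)
    (hC : 0 < C) (hE : E ∈ A) (hL : 1 ≤ L) (hu : IsSolution V E u) (hn : IsNormalized u) :
    solutionGramDet V E L / (C * L ^ (2 * α + 1)) ≤ normSqUpTo u L := by
  have hL0 : 0 ≤ L := zero_le_one.trans hL
  have conjugate_le := ha E hE _ (isSolution_solutionOf V E (-u 1) (u 0))
    (isNormalized_solutionOf V E (by rw [neg_sq, add_comm]; exact hn)) L hL
  have gram_le := solutionGramDet_le_normSqUpTo_mul (V := V) (E := E) hn hL0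
  rw [← hu.eq_solutionOf] at gram_le
  rw [div_le_iff₀ (by positivity)]
  exact gram_le.trans (mul_le_mul_of_nonneg_left conjugate_le (normSqUpTo_nonneg u hL0))

theorem UpperPowerBound.solutionGramDet_le (ha : UpperPowerBound V A C α) (hE : E ∈ A)
    (hL : 1 ≤ L) : solutionGramDet V E L ≤ (C * L ^ (2 * α + 1)) ^ 2 := by
  have hL0 : 0 ≤ L := zero_le_one.trans hL
  have hle {x y : ℝ} (h : x ^ 2 + y ^ 2 = 1) :
      normSqUpTo (solutionOf V E x y) L ≤ C * L ^ (2 * α + 1) :=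
    ha E hE _ (isSolution_solutionOf V E x y) (isNormalized_solutionOf V E h) L hL
  have h10 : (1 : ℝ) ^ 2 + 0 ^ 2 = 1 := by norm_num
  have h01 : (-0 : ℝ) ^ 2 + 1 ^ 2 = 1 := by norm_num
  rw [pow_two]
  exact (solutionGramDet_le_normSqUpTo_mul h10 hL0).trans <| mul_le_mul (hle h10) (hle h01)
    (normSqUpTo_nonneg _ hL0) ((normSqUpTo_nonneg _ hL0).trans (hle h10))

theorem LowerPowerBound.le_normSqUpTo (hc : LowerPowerBound V A D κ L₁) (hD : 0 ≤ D) (hE : E ∈ A)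
    (hu : IsSolution V E u) (hn : IsNormalized u) (hL0 : 0 ≤ L) (hL : L₁ ≤ L) :
    D ^ 2 * L ^ (2 * κ) ≤ normSqUpTo u L := by
  have := (Real.le_sqrt (by positivity) (normSqUpTo_nonneg u hL0)).1 (hc E hE u hu hn L hL)
  rwa [mul_pow, ← Real.rpow_mul_natCast hL0, mul_comm κ] at this

theorem LowerPowerBound.sq_le_solutionGramDet (hc : LowerPowerBound V A D κ L₁) (hD : 0 ≤ D)
    (hE : E ∈ A) (hL0 : 0 ≤ L) (hL : L₁ ≤ L) :
    (D ^ 2 * L ^ (2 * κ)) ^ 2 ≤ solutionGramDet V E L :=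
  Schrodinger1D.sq_le_solutionGramDet hL0 (by positivity) fun _ hu hn =>
    hc.le_normSqUpTo hD hE hu hn hL0 hL

theorem exists_pos_rpow_mul_eq_one {k q : ℝ} (hk0 : 0 < k) (hk1 : k < 1) (hq : 1 < q) :
    ∃ β : ℝ, 0 < β ∧ k ^ β * q = 1 := by
  have hq0 : 0 < q := by linarith
  refine ⟨Real.logb k q⁻¹, Real.logb_pos_of_base_lt_one hk0 hk1 (by positivity)
    (inv_lt_one_of_one_lt₀ hq), ?_⟩
  rw [Real.rpow_logb hk0 hk1.ne (by positivity), inv_mul_cancel₀ hq0.ne']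

theorem mul_rpow_le_of_scaling {f : ℝ → ℝ} {k q R b β : ℝ} (hk0 : 0 < k) (hk1 : k < 1)
    (hβ : 0 ≤ β) (hkβ : k ^ β * q = 1) (hR : 0 < R) (hb : 0 ≤ b) (base : ∀ L, R ≤ L → b ≤ f L)
    (scale : ∀ L, R ≤ L → q * f (k * L) ≤ f L) {L : ℝ} (hL : R ≤ L) :
    b * (k * L / R) ^ β ≤ f L := by
  have hq : 0 ≤ q := nonneg_of_mul_nonneg_right (hkβ ▸ zero_le_one) (by positivity)
  have of_le {L : ℝ} (hL : R ≤ L) (h : k * L ≤ R) : b * (k * L / R) ^ β ≤ f L := by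
    have : 0 ≤ k * L / R := by have := hR.trans_le hL; positivity
    exact (mul_le_of_le_one_right hb
      (Real.rpow_le_one this ((div_le_one hR).2 h) hβ)).trans (base L hL)
  obtain ⟨m, hm⟩ : ∃ m : ℕ, k ^ m * (k * L) ≤ R := by
    obtain ⟨m, hm⟩ := exists_pow_lt_of_lt_one (div_pos hR (hR.trans_le hL)) hk1
    rw [lt_div_iff₀ (hR.trans_le hL)] at hm
    have hkL : k * L ≤ L := mul_le_of_le_one_left (hR.trans_le hL).le hk1.le
    exact ⟨m, (mul_le_mul_of_nonneg_left hkL (by positivity)).trans hm.le⟩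
  induction m generalizing L with
  | zero => exact of_le hL (by simpa using hm)
  | succ m ih =>
    rcases le_total (k * L) R with h | h
    · exact of_le hL h
    have hL0 : 0 < L := hR.trans_le hL
    have rpow_eq : (k * (k * L) / R) ^ β = k ^ β * (k * L / R) ^ β := by
      rw [mul_div_assoc k (k * L), Real.mul_rpow hk0.le (by positivity)]
    calc b * (k * L / R) ^ β = q * (b * (k * (k * L) / R) ^ β) := by
          rw [rpow_eq]
          linear_combination -(b * (k * L / R) ^ β) * hkβ
      _ ≤ q * f (k * L) := mul_le_mul_of_nonneg_left (ih h (by rwa [pow_succ, mul_assoc] at hm)) hq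
      _ ≤ f L := scale L hL

theorem exists_lowerPowerBound {k γ L₀ : ℝ} (hC : 0 < C) (hk0 : 0 < k) (hk1 : k < 1) (hγ : 0 < γ)
    (ha : UpperPowerBound V A C α) (hb : ScalingLowerBound V A k γ L₀) :
    ∃ D κ L₁ : ℝ, 0 < D ∧ 0 < κ ∧ 1 ≤ L₁ ∧ LowerPowerBound V A D κ L₁ := by
  obtain ⟨β, hβ, hkβ⟩ := exists_pos_rpow_mul_eq_one hk0 hk1 (show 1 < 1 + γ by linarith)
  set R := max L₀ 2
  have hR2 : 2 ≤ R := le_max_right _ _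
  have hR0 : 0 < R := by linarith
  set b := 1 / (C * 2 ^ (2 * α + 1))
  have hb0 : 0 < b := by positivity
  refine ⟨√(b * (k / R) ^ β), β / 2, R, by positivity, by positivity, by linarith, ?_⟩
  intro E hE u hu hn L hL
  have hL0 : 0 < L := hR0.trans_le hL
  have base (L : ℝ) (hL : R ≤ L) : b ≤ normSqUpTo u L := by
    have hle := ha.solutionGramDet_div_le_normSqUpTo hC hE one_le_two hu hn
    rw [solutionGramDet_two] at hle
    exact hle.trans (normSqUpTo_mono u zero_le_two (hR2.trans hL))
  have growth := mul_rpow_le_of_scaling hk0 hk1 hβ.le hkβ hR0 hb0.le base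
    (fun L hL => hb E hE u hu L ((le_max_left _ _).trans hL)) hL
  refine Real.le_sqrt_of_sq_le (le_of_eq_of_le ?_ growth)
  rw [mul_pow, Real.sq_sqrt (by positivity), ← Real.rpow_mul_natCast hL0.le, mul_div_right_comm,
    Real.mul_rpow (by positivity) hL0.le, Nat.cast_ofNat, div_mul_cancel₀ _ two_ne_zero, mul_assoc]

end Growth

/-! ### The mass in an annulus -/

section Annulus

variable {F : Type*} [NormedAddCommGroup F] {f g : ℕ → F} {l L γ : ℝ}

theorem norm_sq_le_two_mul_norm_sq_add (x y : F) :
    ‖x‖ ^ 2 ≤ 2 * ‖y‖ ^ 2 + 2 * ‖x - y‖ ^ 2 := by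
  calc ‖x‖ ^ 2 ≤ (‖y‖ + ‖x - y‖) ^ 2 := by gcongr; exact norm_le_norm_add_norm_sub' x y
    _ ≤ 2 * ‖y‖ ^ 2 + 2 * ‖x - y‖ ^ 2 := by rw [← mul_add]; exact add_sq_le

theorem truncSum_norm_sq_le (L : ℝ) (f g : ℕ → F) :
    truncSum L (fun n => ‖f n‖ ^ 2)
      ≤ 2 * truncSum L (fun n => ‖g n‖ ^ 2) + 2 * truncSum L fun n => ‖f n - g n‖ ^ 2 := by
  rw [← truncSum_const_mul, ← truncSum_const_mul, ← truncSum_add]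
  exact truncSum_le_truncSum fun n _ => norm_sq_le_two_mul_norm_sq_add (f n) (g n)

theorem truncSum_sub_truncSum_norm_sq_le (h : l ≤ L) (f g : ℕ → F) :
    truncSum L (fun n => ‖f n‖ ^ 2) - truncSum l (fun n => ‖f n‖ ^ 2)
      ≤ 2 * (truncSum L (fun n => ‖g n‖ ^ 2) - truncSum l fun n => ‖g n‖ ^ 2)
        + 2 * truncSum L fun n => ‖f n - g n‖ ^ 2 := by
  have hle := truncSum_sub_truncSum_le h fun n => norm_sq_le_two_mul_norm_sq_add (f n) (g n)
  simp only [truncSum_add, truncSum_const_mul] at hle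
  linarith [truncSum_nonneg l fun n => sq_nonneg ‖f n - g n‖]

theorem mul_truncSum_le_truncSum_sub_of_close (hγ0 : 0 ≤ γ) (hγ1 : γ ≤ 1) (h : l ≤ L)
    (gap : (1 + γ) * truncSum l (fun n => ‖f n‖ ^ 2) ≤ truncSum L fun n => ‖f n‖ ^ 2)
    (close : truncSum L (fun n => ‖g n - f n‖ ^ 2)
      ≤ γ ^ 2 / 500 * truncSum L fun n => ‖g n‖ ^ 2) :
    γ / 12 * truncSum L (fun n => ‖f n‖ ^ 2)
      ≤ truncSum L (fun n => ‖g n‖ ^ 2) - truncSum l fun n => ‖g n‖ ^ 2 := by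
  have annulus_le := truncSum_sub_truncSum_norm_sq_le h f g
  have total_le := truncSum_norm_sq_le L g f
  simp only [fun n => norm_sub_rev (f n)] at annulus_le
  have f_nonneg := truncSum_nonneg L fun n => sq_nonneg ‖f n‖
  have f_nonneg' := truncSum_nonneg l fun n => sq_nonneg ‖f n‖
  have g_nonneg := truncSum_nonneg L fun n => sq_nonneg ‖g n‖
  have error_nonneg := truncSum_nonneg L fun n => sq_nonneg ‖g n - f n‖
  set Φ := truncSum L fun n => ‖f n‖ ^ 2
  set Φl := truncSum l fun n => ‖f n‖ ^ 2
  set H := truncSum L fun n => ‖g n - f n‖ ^ 2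
  set G := truncSum L fun n => ‖g n‖ ^ 2
  have hγsq : γ ^ 2 ≤ γ := by nlinarith
  have error_le : H ≤ γ / 200 * Φ := by nlinarith
  have half_gap : γ / 2 * Φ ≤ Φ - Φl := by nlinarith
  nlinarith

end Annulus

/-! ### The mass of a complex solution near a real energy -/

section Scale

variable {V : ℤ → ℝ} {A : Set ℝ} {C α D κ L₀ L₁ k γ E L l M p : ℝ} {z : ℂ} {c : ℕ → ℂ}

theorem IsComplexSolution.mul_norm_sq_le_sum_rpow_mul {B : ℝ} (hc : IsComplexSolution V z c)
    (hγ0 : 0 ≤ γ) (hγ1 : γ ≤ 1) (hp : 0 ≤ p) (hB0 : 0 ≤ B) (hl : 0 ≤ l) (h : l ≤ L)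
    (gap : ∀ u, IsSolution V E u → (1 + γ) * normSqUpTo u l ≤ normSqUpTo u L)
    (hB : ∀ u, IsSolution V E u → IsNormalized u → B ≤ normSqUpTo u L)
    (hz : ‖z - E‖ ^ 2 * (2 * solutionGramDet V E L) ≤ γ ^ 2 / 500) :
    γ / 12 * l ^ p * B * ‖c 1‖ ^ 2 ≤ ∑ n ∈ Finset.Icc 1 ⌈L⌉₊, (n : ℝ) ^ p * ‖c n‖ ^ 2 := by
  have hL : 0 ≤ L := hl.trans h
  set φ := complexSolutionOf V E (c 0) (c 1)
  have gap_φ : (1 + γ) * truncSum l (fun n => ‖φ n‖ ^ 2) ≤ truncSum L fun n => ‖φ n‖ ^ 2 := by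
    simp only [φ, truncSum_norm_complexSolutionOf_sq V E _ _ hl,
      truncSum_norm_complexSolutionOf_sq V E _ _ hL, mul_add]
    exact add_le_add (gap _ (isSolution_solutionOf _ _ _ _)) (gap _ (isSolution_solutionOf _ _ _ _))
  have close : truncSum L (fun n => ‖c n - φ n‖ ^ 2)
      ≤ γ ^ 2 / 500 * truncSum L fun n => ‖c n‖ ^ 2 :=
    (hc.truncSum_norm_sub_sq_le E L).trans
      (mul_le_mul_of_nonneg_right hz (truncSum_nonneg L fun _ => sq_nonneg _))
  have mass_φ : B * ‖c 1‖ ^ 2 ≤ truncSum L fun n => ‖φ n‖ ^ 2 :=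
    (mul_le_mul_of_nonneg_left (le_add_of_nonneg_left (sq_nonneg _)) hB0).trans
      (mul_norm_sq_le_truncSum_complexSolutionOf hL hB (c 0) (c 1))
  calc γ / 12 * l ^ p * B * ‖c 1‖ ^ 2 = l ^ p * (γ / 12 * (B * ‖c 1‖ ^ 2)) := by ring
    _ ≤ l ^ p * (γ / 12 * truncSum L fun n => ‖φ n‖ ^ 2) := by gcongr
    _ ≤ l ^ p * (truncSum L (fun n => ‖c n‖ ^ 2) - truncSum l fun n => ‖c n‖ ^ 2) := by
        gcongr
        exact mul_truncSum_le_truncSum_sub_of_close hγ0 hγ1 h gap_φ close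
    _ ≤ ∑ n ∈ Finset.Icc 1 ⌈L⌉₊, (n : ℝ) ^ p * ‖c n‖ ^ 2 :=
        rpow_mul_truncSum_sub_le hp hl h fun _ => sq_nonneg _

theorem exists_solutionGramDet_eq (hD : 0 < D) (hκ : 0 < κ) (ha : UpperPowerBound V A C α)
    (hc : LowerPowerBound V A D κ L₁) (hE : E ∈ A) (hM : 0 ≤ M) (hl : 1 ≤ l) (hlL : L₁ ≤ l)
    (hlM : C * l ^ (2 * α + 1) = M) : ∃ L, l ≤ L ∧ solutionGramDet V E L = M ^ 2 := by
  have growth : Tendsto (fun L : ℝ => D ^ 2 * L ^ (2 * κ)) atTop atTop :=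
    (tendsto_rpow_atTop (by positivity)).const_mul_atTop (by positivity)
  obtain ⟨R, hR, hMR⟩ := ((eventually_ge_atTop l).and (growth.eventually_ge_atTop M)).exists
  have lower : solutionGramDet V E l ≤ M ^ 2 := hlM ▸ ha.solutionGramDet_le hE hl
  have upper : M ^ 2 ≤ solutionGramDet V E R :=
    (pow_le_pow_left₀ hM hMR 2).trans
      (hc.sq_le_solutionGramDet hD.le hE (zero_le_one.trans (hl.trans hR)) (hlL.trans hR))
  obtain ⟨L, hL, hLM⟩ := intermediate_value_Icc hR
    (continuous_gramDet (solutionOf V E 1 0) (solutionOf V E 0 1)).continuousOn ⟨lower, upper⟩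
  exact ⟨L, hL.1, hLM⟩

/-- The lower bound for `‖u‖_L²`, `u` a normalized solution at an energy of `A`, at a scale `L`
where the Gram determinant equals `M²`: the larger of the bound given by (c) and the one that
follows from (a) for the solution whose initial data are those of `u` rotated by `π/2`. -/
def scaleBound (C α D κ M L : ℝ) : ℝ := max (D ^ 2 * L ^ (2 * κ)) (M ^ 2 / (C * L ^ (2 * α + 1)))

theorem scaleBound_nonneg (hL : 0 ≤ L) : 0 ≤ scaleBound C α D κ M L :=
  le_max_of_le_left (by positivity)

theorem scaleBound_le_normSqUpTo (hC : 0 < C) (ha : UpperPowerBound V A C α) (hD : 0 ≤ D)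
    (hc : LowerPowerBound V A D κ L₁) (hE : E ∈ A) (hL : 1 ≤ L) (hL₁ : L₁ ≤ L)
    (hM : solutionGramDet V E L = M ^ 2) {u : ℕ → ℝ} (hu : IsSolution V E u)
    (hn : IsNormalized u) : scaleBound C α D κ M L ≤ normSqUpTo u L :=
  max_le (hc.le_normSqUpTo hD hE hu hn (zero_le_one.trans hL) hL₁)
    (hM ▸ ha.solutionGramDet_div_le_normSqUpTo hC hE hL hu hn)

theorem norm_add_I_mul_sub_sq_le {E E' ε : ℝ} (h : dist E E' < 2 * ε) :
    ‖(E + Complex.I * ε : ℂ) - E'‖ ^ 2 ≤ 5 * ε ^ 2 := by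
  have hsq : (E - E') ^ 2 ≤ (2 * ε) ^ 2 :=
    sq_le_sq' (by linarith [(abs_lt.1 h).1]) (abs_lt.1 h).2.le
  rw [← Complex.normSq_eq_norm_sq, Complex.normSq_apply]
  simp
  linarith

theorem IsComplexSolution.exists_mul_scaleBound_le_sum_rpow_mul (hC : 0 < C) (hk0 : 0 ≤ k)
    (hk1 : k ≤ 1) (hγ0 : 0 ≤ γ) (hγ1 : γ ≤ 1) (ha : UpperPowerBound V A C α)
    (hb : ScalingLowerBound V A k γ L₀) (hD : 0 < D) (hκ : 0 < κ)
    (hc : LowerPowerBound V A D κ L₁) {ε : ℝ} (hM : 0 ≤ M) (hMε : 72 * (M * ε) ≤ γ) (hl1 : 1 ≤ l)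
    (hlL₀ : L₀ ≤ l) (hlL₁ : L₁ ≤ l) (hlM : C * l ^ (2 * α + 1) = M)
    (hE : E ∈ Metric.thickening (2 * ε) A) (hp : 0 ≤ p)
    (hsol : IsComplexSolution V (E + Complex.I * ε) c) :
    ∃ L, l ≤ L ∧ γ / 12 * (k * L) ^ p * scaleBound C α D κ M L * ‖c 1‖ ^ 2
      ≤ ∑ n ∈ Finset.Icc 1 ⌈L⌉₊, (n : ℝ) ^ p * ‖c n‖ ^ 2 := by
  obtain ⟨E', hE', hdist⟩ := Metric.mem_thickening_iff.1 hE
  obtain ⟨L, hlL, hdet⟩ := exists_solutionGramDet_eq hD hκ ha hc hE' hM hl1 hlL₁ hlM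
  have hL1 : 1 ≤ L := hl1.trans hlL
  have hL0 : 0 ≤ L := zero_le_one.trans hL1
  have hε : 0 ≤ ε := by linarith [dist_nonneg.trans_lt hdist]
  have perturbation_le : ‖(E + Complex.I * ε : ℂ) - E'‖ ^ 2 * (2 * solutionGramDet V E' L)
      ≤ γ ^ 2 / 500 := by
    rw [hdet]
    calc _ ≤ 5 * ε ^ 2 * (2 * M ^ 2) :=
          mul_le_mul_of_nonneg_right (norm_add_I_mul_sub_sq_le hdist) (by positivity)
      _ = 10 / 5184 * (72 * (M * ε)) ^ 2 := by ring
      _ ≤ 10 / 5184 * γ ^ 2 := by gcongr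
      _ ≤ γ ^ 2 / 500 := by linarith [sq_nonneg γ]
  exact ⟨L, hlL, hsol.mul_norm_sq_le_sum_rpow_mul hγ0 hγ1 hp (scaleBound_nonneg hL0)
    (by positivity) (mul_le_of_le_one_left hL0 hk1)
    (fun u hu => hb E' hE' u hu L (hlL₀.trans hlL))
    (fun u hu hn => scaleBound_le_normSqUpTo hC ha hD.le hc hE' hL1 (hlL₁.trans hlL) hdet hu hn)
    perturbation_le⟩

end Scale

/-! ### From the Green function to the averaged moment -/

section Moment

variable {X : Lattice} {V : ℤ → ℝ} {p T K : ℝ} {z : ℂ}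

/-- The Green function on the sites `0, 1, 2, …`. Subtracting `1` at the site `0` absorbs the source
`δ₁` in the equation at the site `1`, so that the sequence solves the homogeneous equation. -/
def greenSeq (X : Lattice) (V : ℤ → ℝ) (z : ℂ) (n : ℕ) : ℂ :=
  zeroExt (greenState X V z) n - if n = 0 then 1 else 0

theorem Lattice.natCast_mem_sites (X : Lattice) {n : ℕ} (hn : 1 ≤ n) : (n : ℤ) ∈ X.sites := by
  cases X
  · exact Set.mem_univ _
  · exact Set.mem_Ici.2 (by exact_mod_cast hn)

theorem Lattice.one_eq_mk (X : Lattice) : X.one = ⟨(1 : ℕ), X.natCast_mem_sites le_rfl⟩ := by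
  cases X <;> rfl

theorem greenSeq_of_pos {n : ℕ} (hn : 1 ≤ n) :
    greenSeq X V z n = greenState X V z ⟨n, X.natCast_mem_sites hn⟩ := by
  rw [greenSeq, if_neg (by omega), sub_zero]
  exact zeroExt_coe _ (⟨n, X.natCast_mem_sites hn⟩ : X.sites)

theorem borelTransform_eq_greenSeq (z : ℂ) : borelTransform X V z = greenSeq X V z 1 := by
  rw [borelTransform_eq_greenState, greenSeq_of_pos le_rfl, X.one_eq_mk]

theorem delta_one_natCast_succ (n : ℕ) :
    delta X X.one ⟨(n + 1 : ℕ), X.natCast_mem_sites n.succ_pos⟩ = if n = 0 then 1 else 0 := by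
  rw [X.one_eq_mk, delta, lp.coeFn_single]
  simp [Pi.single_apply]

theorem isComplexSolution_greenSeq (hz : 0 < z.im) : IsComplexSolution V z (greenSeq X V z) := by
  intro n
  have eqn := diffExpr_greenState (V := V) hz ⟨(n + 1 : ℕ), X.natCast_mem_sites n.succ_pos⟩
  rw [diffExpr, delta_one_natCast_succ, ← greenSeq_of_pos n.succ_pos] at eqn
  simp only [greenSeq, show ((n + 1 : ℕ) : ℤ) + 1 = (n + 2 : ℕ) by push_cast; ring,
    show ((n + 1 : ℕ) : ℤ) - 1 = n by push_cast; ring] at eqn ⊢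
  push_cast at eqn ⊢
  linear_combination eqn

theorem ofReal_sum_greenSeq_le_tsum (p : ℝ) (z : ℂ) (N : ℕ) :
    ENNReal.ofReal (∑ n ∈ Finset.Icc 1 N, (n : ℝ) ^ p * ‖greenSeq X V z n‖ ^ 2)
      ≤ ∑' n : X.sites, ENNReal.ofReal (|((n : ℤ) : ℝ)| ^ p) * ‖greenState X V z n‖ₑ ^ 2 := by
  let ι (n : Finset.Icc 1 N) : X.sites :=
    ⟨((n : ℕ) : ℤ), X.natCast_mem_sites (Finset.mem_Icc.1 n.2).1⟩
  have hι : Function.Injective ι := fun a b hab =>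
    Subtype.ext (Nat.cast_injective (congrArg Subtype.val hab))
  rw [ENNReal.ofReal_sum_of_nonneg fun n _ => by positivity, ← Finset.sum_coe_sort,
    ← tsum_fintype (L := .unconditional _)]
  refine le_of_eq_of_le (tsum_congr fun n => ?_) (ENNReal.tsum_comp_le_tsum_of_injective hι _)
  rw [ENNReal.ofReal_mul (by positivity), greenSeq_of_pos (Finset.mem_Icc.1 n.2).1,
    ENNReal.ofReal_pow (norm_nonneg _), ofReal_norm]
  simp [ι]

theorem ofReal_mul_imIntegral_le_avgMoment {Δ : Set ℝ} (hT : 0 < T) (hK : 0 ≤ K)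
    (hΔ : MeasurableSet Δ)
    (h : ∀ E ∈ Δ, ∃ N : ℕ, K * ‖greenSeq X V (E + Complex.I * (1 / T : ℝ)) 1‖ ^ 2
      ≤ ∑ n ∈ Finset.Icc 1 N, (n : ℝ) ^ p * ‖greenSeq X V (E + Complex.I * (1 / T : ℝ)) n‖ ^ 2) :
    ENNReal.ofReal (K / Real.pi) * imIntegral X V Δ (1 / T) ≤ avgMoment X V p T := by
  have pointwise (E : ℝ) (hE : E ∈ Δ) : ENNReal.ofReal K *
        ENNReal.ofReal ((borelTransform X V (E + Complex.I * (1 / T : ℝ))).im ^ 2)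
      ≤ ∑' n : X.sites, ENNReal.ofReal (|((n : ℤ) : ℝ)| ^ p) *
        ‖greenState X V (E + Complex.I * (1 / T : ℝ)) n‖ₑ ^ 2 := by
    obtain ⟨N, hN⟩ := h E hE
    refine le_trans ?_ (ofReal_sum_greenSeq_le_tsum p _ N)
    rw [← ENNReal.ofReal_mul hK, borelTransform_eq_greenSeq]
    refine ENNReal.ofReal_le_ofReal (le_trans (mul_le_mul_of_nonneg_left ?_ hK) hN)
    exact sq_le_sq.2 ((Complex.abs_im_le_norm _).trans_eq (abs_norm _).symm)
  rw [avgMoment_eq_lintegral_greenState V p hT, imIntegral, ← mul_assoc,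
    ← ENNReal.ofReal_mul (by positivity), show K / Real.pi * (1 / T) = 1 / T / Real.pi * K by ring,
    ENNReal.ofReal_mul (by positivity), mul_assoc, ← lintegral_const_mul' _ _ ENNReal.ofReal_ne_top]
  gcongr _ * ?_
  exact (setLIntegral_mono' hΔ pointwise).trans (setLIntegral_le_lintegral _ _)

theorem ofReal_mul_imIntegral_thickening_le_avgMoment {A : Set ℝ} {C α D κ L₀ L₁ k γ l q : ℝ}
    (hC : 0 < C) (hk0 : 0 < k) (hk1 : k < 1) (hγ0 : 0 < γ) (hγ1 : γ < 1)
    (ha : UpperPowerBound V A C α) (hb : ScalingLowerBound V A k γ L₀) (hD : 0 < D) (hκ : 0 < κ)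
    (hc : LowerPowerBound V A D κ L₁) (hT : 0 < T) (hl1 : 1 ≤ l) (hlL₀ : L₀ ≤ l) (hlL₁ : L₁ ≤ l)
    (hl : C * l ^ (2 * α + 1) = γ * T / 72) (hq : 0 ≤ q) (hqp : q ≤ p) (hK : 0 ≤ K)
    (h : ∀ L, l ≤ L → K ≤ L ^ q * scaleBound C α D κ (γ * T / 72) L) :
    ENNReal.ofReal (γ * k ^ q / (12 * Real.pi) * K) *
      imIntegral X V (Metric.thickening (2 * (1 / T)) A) (1 / T) ≤ avgMoment X V p T := by
  rw [show γ * k ^ q / (12 * Real.pi) * K = γ / 12 * k ^ q * K / Real.pi by field_simp]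
  refine ofReal_mul_imIntegral_le_avgMoment hT (by positivity)
    Metric.isOpen_thickening.measurableSet fun E hE => ?_
  have hsol := isComplexSolution_greenSeq (X := X) (V := V)
    (z := E + Complex.I * (1 / T : ℝ)) (by simpa using hT)
  obtain ⟨L, hlL, hsum⟩ := hsol.exists_mul_scaleBound_le_sum_rpow_mul hC hk0.le hk1.le hγ0.le hγ1.le
    ha hb hD hκ hc (M := γ * T / 72) (by positivity) (le_of_eq (by field_simp)) hl1 hlL₀ hlL₁ hl
    hE hq
  have hL : 0 ≤ L := by linarith
  refine ⟨⌈L⌉₊, le_trans ?_ (hsum.trans (Finset.sum_le_sum fun n hn => ?_))⟩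
  · rw [Real.mul_rpow hk0.le hL]
    calc _ ≤ γ / 12 * k ^ q * (L ^ q * scaleBound C α D κ (γ * T / 72) L) * _ := by
          gcongr
          exact h L hlL
      _ = _ := by ring
  · have : (1 : ℝ) ≤ n := by exact_mod_cast (Finset.mem_Icc.1 hn).1
    gcongr

end Moment

/-! ### Optimisation over the scale -/

section Optimisation

variable {C D L M T l p r α β γ κ : ℝ}

theorem exists_le_mul_rpow_eq (hC : 0 < C) (hβ : 0 < β) (hr : 0 ≤ r) (h : C * r ^ β ≤ M) :
    ∃ l, r ≤ l ∧ C * l ^ β = M := by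
  have hM : 0 ≤ M / C := div_nonneg (le_trans (by positivity) h) hC.le
  refine ⟨(M / C) ^ β⁻¹, ?_, ?_⟩
  · rwa [Real.le_rpow_inv_iff_of_pos hr hM hβ, le_div_iff₀' hC]
  · rw [Real.rpow_inv_rpow hM hβ.ne', mul_div_cancel₀ _ hC.ne']

theorem rpow_one_sub_mul_rpow_le_max {a b θ : ℝ} (ha : 0 ≤ a) (hb : 0 ≤ b) (hθ0 : 0 ≤ θ)
    (hθ1 : θ ≤ 1) : a ^ (1 - θ) * b ^ θ ≤ max a b := by
  have hm : 0 ≤ max a b := le_max_of_le_left ha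
  calc a ^ (1 - θ) * b ^ θ ≤ max a b ^ (1 - θ) * max a b ^ θ := by
        gcongr
        exacts [le_max_left a b, le_max_right a b]
    _ = max a b := by
        rw [← Real.rpow_add_of_nonneg hm (sub_nonneg.2 hθ1) hθ0, sub_add_cancel, Real.rpow_one]

theorem rpow_mul_rpow_le_rpow_mul_scaleBound (hC : 0 < C) (hD : 0 < D) (hκ : 0 ≤ κ) (hL : 0 < L)
    (hp : 0 < p) (hpα : p ≤ 2 * α + 1) :
    (M ^ 2 / C) ^ ((p + 2 * κ) / (2 * α + 1 + 2 * κ)) *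
        D ^ (2 - 2 * ((p + 2 * κ) / (2 * α + 1 + 2 * κ)))
      ≤ L ^ p * scaleBound C α D κ M L := by
  have hs : 0 < 2 * α + 1 + 2 * κ := by linarith
  set θ := (p + 2 * κ) / (2 * α + 1 + 2 * κ)
  -- With this weight all powers of `L` in the geometric mean cancel.
  have hθs : θ * (2 * α + 1 + 2 * κ) = p + 2 * κ := div_mul_cancel₀ _ hs.ne'
  have hθ0 : 0 ≤ θ := by positivity
  have hθ1 : θ ≤ 1 := (div_le_one hs).2 (by linarith)
  have hfst : (D ^ 2 * L ^ (2 * κ)) ^ (1 - θ) = D ^ (2 - 2 * θ) * L ^ (2 * κ * (1 - θ)) := by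
    rw [Real.mul_rpow (by positivity) (by positivity), ← Real.rpow_natCast_mul hD.le,
      ← Real.rpow_mul hL.le]
    congr 2
    push_cast
    ring
  have hsnd : (M ^ 2 / (C * L ^ (2 * α + 1))) ^ θ = (M ^ 2 / C) ^ θ * L ^ (-((2 * α + 1) * θ)) := by
    rw [← div_div, Real.div_rpow (by positivity) (by positivity), ← Real.rpow_mul hL.le,
      Real.rpow_neg hL.le, div_eq_mul_inv]
  have hexp : L ^ p * (L ^ (2 * κ * (1 - θ)) * L ^ (-((2 * α + 1) * θ))) = 1 := by
    rw [← Real.rpow_add hL, ← Real.rpow_add hL]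
    convert Real.rpow_zero L using 2
    linear_combination -hθs
  calc (M ^ 2 / C) ^ θ * D ^ (2 - 2 * θ)
      = L ^ p * ((D ^ 2 * L ^ (2 * κ)) ^ (1 - θ) * (M ^ 2 / (C * L ^ (2 * α + 1))) ^ θ) := by
        rw [hfst, hsnd]
        linear_combination -((M ^ 2 / C) ^ θ * D ^ (2 - 2 * θ)) * hexp
    _ ≤ _ := by
        gcongr
        exact rpow_one_sub_mul_rpow_le_max (by positivity) (by positivity) hθ0 hθ1

theorem mul_div_sq_div_eq (hC : C ≠ 0) :
    (γ * T / 72) ^ 2 / C = γ ^ 2 / (5184 * C) * T ^ 2 := by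
  field_simp
  norm_num

theorem interpolated_le_rpow_mul_scaleBound (hC : 0 < C) (hD : 0 < D) (hκ : 0 ≤ κ) (hT : 0 ≤ T)
    (hL : 0 < L) (hp : 0 < p) (hpα : p ≤ 2 * α + 1) :
    (γ ^ 2 / (5184 * C)) ^ ((p + 2 * κ) / (2 * α + 1 + 2 * κ)) *
        D ^ (2 - 2 * (p + 2 * κ) / (2 * α + 1 + 2 * κ)) *
        T ^ (2 * (p + 2 * κ) / (2 * α + 1 + 2 * κ))
      ≤ L ^ p * scaleBound C α D κ (γ * T / 72) L := by
  refine le_of_eq_of_le ?_ (rpow_mul_rpow_le_rpow_mul_scaleBound hC hD hκ hL hp hpα)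
  rw [mul_div_sq_div_eq hC.ne', Real.mul_rpow (by positivity) (by positivity),
    ← Real.rpow_natCast_mul hT, mul_div_assoc, Nat.cast_ofNat, mul_right_comm]

theorem quadratic_le_rpow_mul_scaleBound (hC : 0 < C) (hL : 0 < L) :
    γ ^ 2 / (5184 * C) * T ^ 2 ≤ L ^ (2 * α + 1) * scaleBound C α D κ (γ * T / 72) L :=
  calc γ ^ 2 / (5184 * C) * T ^ 2
      = L ^ (2 * α + 1) * ((γ * T / 72) ^ 2 / (C * L ^ (2 * α + 1))) := by
        rw [← mul_div_sq_div_eq hC.ne']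
        field_simp
    _ ≤ _ := by
        gcongr
        exact le_max_right _ _

theorem mul_rpow_le_rpow_mul_scaleBound (hκ : 0 ≤ κ) (hp : 0 ≤ p) (hl : 0 ≤ l) (hlL : l ≤ L)
    (hL : 0 < L) : D ^ 2 * l ^ (p + 2 * κ) ≤ L ^ p * scaleBound C α D κ M L :=
  calc D ^ 2 * l ^ (p + 2 * κ) ≤ D ^ 2 * L ^ (p + 2 * κ) := by gcongr
    _ = L ^ p * (D ^ 2 * L ^ (2 * κ)) := by rw [Real.rpow_add hL]; ring
    _ ≤ _ := by
        gcongr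
        exact le_max_left _ _

theorem rpow_mul_rpow_le_rpow_of_mul_rpow_eq (hC : 1 ≤ C) (hα : 0 ≤ α) (hγ0 : 0 < γ) (hγ1 : γ ≤ 1)
    (hT : 0 ≤ T) (hβ : 0 ≤ β) (hl0 : 0 ≤ l) (hl : C * l ^ (2 * α + 1) = γ * T / 72) :
    (γ ^ 2 / (5184 * C ^ 2)) ^ (β / 2) * T ^ (β / (2 * α + 1)) ≤ l ^ β := by
  have hs : 1 ≤ 2 * α + 1 := by linarith
  have hbase : γ / (72 * C) ≤ 1 := by
    rw [div_le_one (by positivity)]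
    linarith
  have hsq : (γ ^ 2 / (5184 * C ^ 2)) ^ (β / 2) = (γ / (72 * C)) ^ β := by
    rw [show γ ^ 2 / (5184 * C ^ 2) = (γ / (72 * C)) ^ 2 by ring,
      ← Real.rpow_natCast_mul (by positivity), Nat.cast_ofNat, mul_div_cancel₀ _ two_ne_zero]
  have hpow : γ / (72 * C) * T = l ^ (2 * α + 1) := by
    rw [div_mul_eq_mul_div, div_eq_iff (by positivity)]
    linear_combination -72 * hl
  calc (γ ^ 2 / (5184 * C ^ 2)) ^ (β / 2) * T ^ (β / (2 * α + 1))
      ≤ (γ / (72 * C)) ^ (β / (2 * α + 1)) * T ^ (β / (2 * α + 1)) := by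
        rw [hsq]
        gcongr ?_ * _
        exact Real.rpow_le_rpow_of_exponent_ge (by positivity) hbase (div_le_self hβ hs)
    _ = l ^ β := by
        rw [← Real.mul_rpow (by positivity) hT, hpow, ← Real.rpow_mul hl0,
          mul_div_cancel₀ _ (by positivity)]

theorem longScale_le_rpow_mul_scaleBound (hC : 1 ≤ C) (hα : 0 ≤ α) (hκ : 0 ≤ κ) (hγ0 : 0 < γ)
    (hγ1 : γ ≤ 1) (hT : 0 ≤ T) (hp : 0 ≤ p) (hl0 : 0 ≤ l)
    (hl : C * l ^ (2 * α + 1) = γ * T / 72) (hlL : l ≤ L) (hL : 0 < L) :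
    (γ ^ 2 / (5184 * C ^ 2)) ^ ((p + 2 * κ) / 2) * D ^ 2 * T ^ ((p + 2 * κ) / (2 * α + 1))
      ≤ L ^ p * scaleBound C α D κ (γ * T / 72) L :=
  calc _ = D ^ 2 * ((γ ^ 2 / (5184 * C ^ 2)) ^ ((p + 2 * κ) / 2) *
        T ^ ((p + 2 * κ) / (2 * α + 1))) := by ring
    _ ≤ D ^ 2 * l ^ (p + 2 * κ) := by
        gcongr
        exact rpow_mul_rpow_le_rpow_of_mul_rpow_eq hC hα hγ0 hγ1 hT (by positivity) hl0 hl
    _ ≤ _ := mul_rpow_le_rpow_mul_scaleBound hκ hp hl0 hlL hL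

end Optimisation

end

end Schrodinger1D

theorem theorem1 (X : Lattice) (V : ℤ → ℝ) (A : Set ℝ) (C α k γ L₀ : ℝ)
    (hC : 0 < C) (hα : 0 < α) (hk0 : 0 < k) (hk1 : k < 1) (hγ0 : 0 < γ) (hγ1 : γ < 1)
    (hL₀ : 1 ≤ L₀)
    (ha : UpperPowerBound V A C α) (hb : ScalingLowerBound V A k γ L₀) :
    (∃ D κ L₁ : ℝ, 0 < D ∧ 0 < κ ∧ 1 ≤ L₁ ∧ LowerPowerBound V A D κ L₁) ∧
    ∀ D κ L₁ : ℝ, 0 < D → 0 < κ → 1 ≤ L₁ → LowerPowerBound V A D κ L₁ →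
      ∃ T₀ : ℝ, 0 < T₀ ∧ ∀ T : ℝ, T₀ ≤ T → ∀ p : ℝ, 0 < p →
        (p ≤ 2 * α + 1 →
          ENNReal.ofReal (γ * k ^ p / (12 * Real.pi) *
                (γ ^ 2 / (5184 * C)) ^ ((p + 2 * κ) / (2 * α + 1 + 2 * κ)) *
                D ^ (2 - 2 * (p + 2 * κ) / (2 * α + 1 + 2 * κ)) *
                T ^ (2 * (p + 2 * κ) / (2 * α + 1 + 2 * κ))) *
              imIntegral X V (Metric.thickening (2 * (1 / T)) A) (1 / T)
            ≤ avgMoment X V p T) ∧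
        (2 * α + 1 < p →
          ENNReal.ofReal (γ * k ^ (2 * α + 1) / (12 * Real.pi) * (γ ^ 2 / (5184 * C)) * T ^ 2) *
              imIntegral X V (Metric.thickening (2 * (1 / T)) A) (1 / T)
            ≤ avgMoment X V p T ∧
          ENNReal.ofReal (γ * k ^ p / (12 * Real.pi) *
                (γ ^ 2 / (5184 * C ^ 2)) ^ ((p + 2 * κ) / 2) * D ^ 2 *
                T ^ ((p + 2 * κ) / (2 * α + 1))) *
              imIntegral X V (Metric.thickening (2 * (1 / T)) A) (1 / T)
            ≤ avgMoment X V p T) := by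
  refine ⟨exists_lowerPowerBound hC hk0 hk1 hγ0 ha hb, fun D κ L₁ hD hκ _ hc => ?_⟩
  set r := max L₀ L₁
  have hr1 : 1 ≤ r := hL₀.trans (le_max_left _ _)
  have hr0 : 0 < r := one_pos.trans_le hr1
  refine ⟨72 * C / γ * r ^ (2 * α + 1), by positivity, fun T hT₀ p hp => ?_⟩
  obtain rfl | hA := A.eq_empty_or_nonempty
  · simp [imIntegral]
  have hT : 0 < T := lt_of_lt_of_le (by positivity) hT₀
  obtain ⟨l, hrl, hl⟩ : ∃ l, r ≤ l ∧ C * l ^ (2 * α + 1) = γ * T / 72 :=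
    exists_le_mul_rpow_eq hC (by positivity) hr0.le (by field_simp at hT₀ ⊢; linarith)
  have hl0 : 0 < l := hr0.trans_le hrl
  have moment_ge {q K : ℝ} := ofReal_mul_imIntegral_thickening_le_avgMoment (X := X) (p := p)
    (q := q) (K := K) hC hk0 hk1 hγ0 hγ1 ha hb hD hκ hc hT (hr1.trans hrl)
    ((le_max_left _ _).trans hrl) ((le_max_right _ _).trans hrl) hl
  refine ⟨fun hpα => ?_, fun hpα => ⟨?_, ?_⟩⟩
  · simpa only [mul_assoc] using moment_ge hp.le le_rfl (by positivity) fun L hlL =>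
      interpolated_le_rpow_mul_scaleBound hC hD hκ.le hT.le (hl0.trans_le hlL) hp hpα
  · simpa only [mul_assoc] using moment_ge (by positivity) hpα.le (by positivity) fun L hlL =>
      quadratic_le_rpow_mul_scaleBound hC (hl0.trans_le hlL)
  · simpa only [mul_assoc] using moment_ge hp.le le_rfl (by positivity) fun L hlL =>
      longScale_le_rpow_mul_scaleBound (ha.one_le hA) hα.le hκ.le hγ0 hγ1.le hT.le hp.le hl0.le hl
        hlL (hl0.trans_le hlL)
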